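/- For a finite simple graph $G$ with vertex set $V$, let $X_G=\sum_{\kappa}\prod_{v\in V}x_{\kappa(v)}$ be its chromatic symmetric function in countably many commuting variables $x_1,x_2,\dots$, where $\kappa$ runs over all proper colorings of $G$ by positive integers. For an integer partition $\lambda$ let $e_\lambda=e_{\lambda_1}e_{\lambda_2}\cdots$, with $e_n=\sum_{i_1<\dots<i_n}x_{i_1}\cdots x_{i_n}$, be the elementary symmetric function, and let $s_\lambda$ be the Schur function, i.e. the sum of the monomials of all semistandard Young tableaux of shape $\lambda$. The graph $G$ is called $e$-positive (resp. Schur positive) if all coefficients of the expansion of $X_G$ in the basis $\{e_\lambda\}$ (resp. $\{s_\lambda\}$) are nonnegative. It is called claw-free if no induced subgraph of it is isomorphic to $K_{1,3}$. For $m\ge 3$ and $l\ge 1$ let the tadpole $\mathrm{Tp}_{m,l}$ be the graph on $m+l$ vertices formed from the disjoint union of the cycle $C_m$ and the path $P_l$ (on $l$ vertices) by adding one edge that joins a vertex of $C_m$ to an end of $P_l$, and let $L(\mathrm{Tp}_{m,l})$ be its line graph. **Corollary.** For all integers $m\ge 3$ and $l\ge 1$, the line graph $L(\mathrm{Tp}_{m,l})$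 is $e$-positive. Moreover, $L(\mathrm{Tp}_{m,l})$ is claw-free and Schur positive, so that it satisfies the Stanley–Gasharov conjecture that every claw-free graph is Schur positive. -/

import Mathlib

open scoped SimpleGraph

/-- The formal sum `∑ i, x ^ (w i)` of a family of monomials in the countably many commuting
variables `x 0, x 1, x 2, …`: the coefficient of `x ^ d` is the number of indices `i` with
`w i = d`.  It is only used for families in which each monomial occurs finitely often (see the
lemmas `finite_…` below). -/
noncomputable def monomialSum {ι : Type*} (w : ι → (ℕ →₀ ℕ)) : MvPowerSeries ℕ ℚ :=
  fun d => (Nat.card {i : ι // w i = d} : ℚ)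

theorem coeff_monomialSum {ι : Type*} (w : ι → (ℕ →₀ ℕ)) (d : ℕ →₀ ℕ) :
    MvPowerSeries.coeff d (monomialSum w) = (Nat.card {i : ι // w i = d} : ℚ) := rfl

/-- The exponent of the monomial `∏ v, x (κ v)` of a coloring `κ` of a finite graph. -/
noncomputable def coloringWeight {V : Type*} {G : SimpleGraph V} (κ : G.Coloring ℕ) : ℕ →₀ ℕ :=
  ∑ᶠ v : V, Finsupp.single (κ v) 1

/-- The chromatic symmetric function `X_G = ∑ κ, ∏ v, x (κ v)` of a finite simple graph, the sum
being over all proper colorings `κ` of `G` with colors indexing the variables. -/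
noncomputable def chromaticSymmetricFunction {V : Type*} [Finite V] (G : SimpleGraph V) :
    MvPowerSeries ℕ ℚ :=
  monomialSum (fun κ : G.Coloring ℕ => coloringWeight κ)

/-- The elementary symmetric function `e_n = ∑ x (i₁) ⋯ x (iₙ)` over `i₁ < ⋯ < iₙ`, that is, over
all `n`-element sets of variables. -/
noncomputable def elementarySymmetric (n : ℕ) : MvPowerSeries ℕ ℚ :=
  monomialSum (fun s : {s : Finset ℕ // s.card = n} => ∑ i ∈ s.1, Finsupp.single i 1)

/-- The elementary symmetric function `e_λ = e_{λ₁} e_{λ₂} ⋯` of an integer partition. -/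
noncomputable def elementaryPartition (p : (n : ℕ) × n.Partition) : MvPowerSeries ℕ ℚ :=
  (p.2.parts.map elementarySymmetric).prod

/-- The exponent of the monomial of a semistandard Young tableau: `x i` occurs as often as the
entry `i`. -/
noncomputable def tableauWeight {μ : YoungDiagram} (T : SemistandardYoungTableau μ) : ℕ →₀ ℕ :=
  ∑ c ∈ μ.cells, Finsupp.single (T c.1 c.2) 1

/-- The Schur function `s_μ`, the sum of the monomials of all semistandard Young tableaux of
shape `μ`. -/
noncomputable def schurFunction (μ : YoungDiagram) : MvPowerSeries ℕ ℚ :=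
  monomialSum (fun T : SemistandardYoungTableau μ => tableauWeight T)

/-- `f` is a finite linear combination of the `b i` with nonnegative coefficients. For a linearly
independent family (such as the `e_λ` or the `s_λ`) this says that `f` has an expansion in
the family and that all coefficients of this expansion are nonnegative. -/
def IsPositiveIn {ι : Type*} (b : ι → MvPowerSeries ℕ ℚ) (f : MvPowerSeries ℕ ℚ) : Prop :=
  ∃ c : ι →₀ ℚ, (∀ i, 0 ≤ c i) ∧ f = c.sum (fun i a => a • b i)

namespace SimpleGraph

/-- A graph is `e`-positive if its chromatic symmetric function is. -/
def IsEPositive {V : Type*} [Finite V] (G : SimpleGraph V) : Prop :=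
  IsPositiveIn elementaryPartition (chromaticSymmetricFunction G)

/-- A graph is Schur positive if its chromatic symmetric function is. -/
def IsSchurPositive {V : Type*} [Finite V] (G : SimpleGraph V) : Prop :=
  IsPositiveIn schurFunction (chromaticSymmetricFunction G)

/-- A graph is claw-free if it has no induced subgraph isomorphic to `K_{1,3}`. -/
def IsClawFree {V : Type*} (G : SimpleGraph V) : Prop :=
  ¬ (completeBipartiteGraph (Fin 1) (Fin 3)).IsIndContained G

/-- The tadpole `Tp_{m,l}` on `m + l` vertices: the cycle `C_m` with a pendant path that consists of
`l` further vertices, i.e. the disjoint union of `C_m` and `P_l` together with one edge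
joining a vertex of `C_m` to an end of `P_l`. -/
def tadpole (m l : ℕ) : SimpleGraph (Fin m ⊕ Fin l) :=
  (cycleGraph m ⊕g pathGraph l) ⊔
    fromRel (fun a b => ∃ (i : Fin m) (j : Fin l),
      i.val = 0 ∧ j.val = 0 ∧ a = Sum.inl i ∧ b = Sum.inr j)

end SimpleGraph

theorem finite_coloring_of_weight {V : Type*} [Finite V] (G : SimpleGraph V) (d : ℕ →₀ ℕ) :
    Finite {κ : G.Coloring ℕ // coloringWeight κ = d} := by
  classical
  have := Fintype.ofFinite V
  refine Finite.of_injective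
    (β := V → d.support) (fun κ v => ⟨κ.1 v, ?_⟩) ?_
  · have h := congrArg (fun f : ℕ →₀ ℕ => f (κ.1 v)) κ.2
    simp only [coloringWeight, finsum_eq_sum_of_fintype, Finsupp.finsetSum_apply] at h
    rw [Finsupp.mem_support_iff, ← h]
    refine (Finset.sum_pos' (fun _ _ => Nat.zero_le _) ⟨v, Finset.mem_univ v, ?_⟩).ne'
    simp
  · intro κ κ' h
    apply Subtype.ext
    apply RelHom.ext
    intro v
    exact congrArg Subtype.val (congrFun h v)

theorem finite_finset_of_weight (n : ℕ) (d : ℕ →₀ ℕ) :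
    Finite {s : {s : Finset ℕ // s.card = n} // ∑ i ∈ s.1, Finsupp.single i 1 = d} := by
  classical
  refine Finite.of_injective
    (β := d.support.powerset) (fun s => ⟨s.1.1, ?_⟩) ?_
  · rw [Finset.mem_powerset]
    intro j hj
    have h := congrArg (fun f : ℕ →₀ ℕ => f j) s.2
    simp only [Finsupp.finsetSum_apply] at h
    rw [Finsupp.mem_support_iff, ← h]
    refine (Finset.sum_pos' (fun _ _ => Nat.zero_le _) ⟨j, hj, ?_⟩).ne'
    simp
  · intro s s' h
    exact Subtype.ext (Subtype.ext (Subtype.mk.inj h))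

theorem finite_tableau_of_weight (μ : YoungDiagram) (d : ℕ →₀ ℕ) :
    Finite {T : SemistandardYoungTableau μ // tableauWeight T = d} := by
  classical
  refine Finite.of_injective
    (β := μ.cells → d.support) (fun T c => ⟨T.1 c.1.1 c.1.2, ?_⟩) ?_
  · have h := congrArg (fun f : ℕ →₀ ℕ => f (T.1 c.1.1 c.1.2)) T.2
    simp only [tableauWeight, Finsupp.finsetSum_apply] at h
    rw [Finsupp.mem_support_iff, ← h]
    refine (Finset.sum_pos' (fun _ _ => Nat.zero_le _) ⟨c.1, c.2, ?_⟩).ne'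
    simp
  · intro T T' h
    apply Subtype.ext
    apply SemistandardYoungTableau.ext
    intro i j
    by_cases hc : (i, j) ∈ μ
    · exact congrArg Subtype.val (congrFun h ⟨(i, j), hc⟩)
    · rw [T.1.zeros hc, T'.1.zeros hc]

/-! ### Calculus of monomial sums -/

/-! A tadpole has as many edges as vertices. With the edges listed around the cycle and then along
the tail, its line graph is the path 0, 1, …, m+l-1 with 0 joined also to m-1 and m. Proper
colorings are thus words without equal neighbours whose first letter avoids two further ones; write
D for their generating function.

Write P_n for the path sums, L(m, n) for the lasso sums and C_m = L(m, m) for the cycle sum. Cutting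
a word after m letters and comparing indicator functions of three letters gives D + P = L(m) +
L(m+1) and L(m) + P = L(m+1) + C_m P_l (`doubleLassoSum_add_pathSum`, `lassoSum_add_pathSum`), all
at n = m+l. Hence D = 2 L(m, m+l) - C_m P_l.

A bijection on pairs (set, word) yields P(z) · (1 - ∑ (k-1) e_k z^k) = E(z)
(`sum_elementarySymmetric_mul_pathSum_eq`). With K_t the coefficients of the inverse series and S(l,
r) the straddle sums, the lasso recursion is solved by L(m, m+l) = ∑ (r-1) S(l, r) K_t over r+t = m.
The difference 2L - C_m P_l then becomes a manifestly positive polynomial in the e_k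
(`two_mul_lassoFormula_sub_mem`), which gives e-positivity.

Schur positivity follows because every e_λ is Schur positive, by iterating the dual Pieri rule from
s_∅ = 1. That rule is proved in finitely many variables on Gelfand–Tsetlin sums, where adding a
vertical strip commutes with removing a horizontal one up to a factor 1 + xy (`strip_commutation`).
Claw-freeness is a pigeonhole argument valid for every line graph. -/

theorem monomialSum_congr {ι κ : Type*} {w : ι → ℕ →₀ ℕ} {w' : κ → ℕ →₀ ℕ} (e : ι ≃ κ)
    (h : ∀ i, w' (e i) = w i) : monomialSum w = monomialSum w' := by
  ext d
  simp only [coeff_monomialSum]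
  congr 1
  exact Nat.card_congr (e.subtypeEquiv fun i => by rw [h])

theorem monomialSum_unique {ι : Type*} [Unique ι] (w : ι → ℕ →₀ ℕ) :
    monomialSum w = MvPowerSeries.monomial (w default) 1 := by
  classical
  ext d
  rw [coeff_monomialSum, MvPowerSeries.coeff_monomial]
  split_ifs with h
  · have : Unique {i : ι // w i = d} :=
      ⟨⟨⟨default, h.symm⟩⟩, fun x => Subtype.ext (Subsingleton.elim _ _)⟩
    simp
  · have : IsEmpty {i : ι // w i = d} :=
      ⟨fun x => h (by rw [← x.2, Subsingleton.elim x.1 default])⟩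
    simp

theorem monomialSum_of_isEmpty {ι : Type*} [IsEmpty ι] (w : ι → ℕ →₀ ℕ) : monomialSum w = 0 := by
  ext d
  simp [coeff_monomialSum]

theorem finite_fiber_comp {ι κ : Type*} {w : ι → ℕ →₀ ℕ} (hw : ∀ d, Finite {i // w i = d})
    {f : κ → ι} (hf : Function.Injective f) (d : ℕ →₀ ℕ) : Finite {k // w (f k) = d} :=
  have := hw d
  Finite.of_injective (fun k : {k // w (f k) = d} => (⟨f k.1, k.2⟩ : {i // w i = d}))
    fun _ _ h => Subtype.ext (hf (congrArg Subtype.val h))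

theorem coeff_monomialSum_subtype {ι : Type*} {w : ι → ℕ →₀ ℕ} {d : ℕ →₀ ℕ}
    (hw : {i | w i = d}.Finite) (p : ι → Prop) [DecidablePred p] :
    MvPowerSeries.coeff d (monomialSum fun i : {i // p i} => w i) =
      ∑ i ∈ hw.toFinset, if p i then (1 : ℚ) else 0 := by
  rw [coeff_monomialSum, Finset.sum_boole]
  rw [← Nat.card_eq_finsetCard]
  congr 1
  exact Nat.card_congr
    ⟨fun x => ⟨x.1.1, by simp [x.2, x.1.2]⟩,
      fun x => ⟨⟨x.1, (Finset.mem_filter.1 x.2).2⟩,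
        hw.mem_toFinset.1 (Finset.mem_filter.1 x.2).1⟩, fun _ => rfl, fun _ => rfl⟩

/-- Finite fibres matter here: `Nat.card` of an infinite type is 0, so additivity would fail without
them. -/
theorem monomialSum_eq_sum_fiber {ι κ : Type*} {w : ι → ℕ →₀ ℕ} (hw : ∀ d, Finite {i // w i = d})
    (g : ι → κ) (s : Finset κ) (hg : ∀ i, g i ∈ s) :
    monomialSum w = ∑ k ∈ s, monomialSum (fun i : {i // g i = k} => w i) := by
  classical
  ext d
  have hd : {i | w i = d}.Finite := hw d
  simp only [map_sum, coeff_monomialSum_subtype hd]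
  rw [Finset.sum_comm, coeff_monomialSum]
  simp only [Finset.sum_ite_eq, hg, if_true, Finset.sum_const, nsmul_eq_mul, mul_one]
  rw [← Nat.card_eq_finsetCard]
  congr 1
  exact Nat.card_congr (Equiv.subtypeEquivRight fun i => by simp)

theorem monomialSum_mul {ι κ : Type*} {w : ι → ℕ →₀ ℕ} {w' : κ → ℕ →₀ ℕ}
    (hw : ∀ d, Finite {i // w i = d}) (hw' : ∀ d, Finite {i // w' i = d}) :
    monomialSum w * monomialSum w' = monomialSum fun x : ι × κ => w x.1 + w' x.2 := by
  classical
  ext d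
  rw [MvPowerSeries.coeff_mul, coeff_monomialSum]
  simp only [coeff_monomialSum]
  have e : {x : ι × κ // w x.1 + w' x.2 = d} ≃
      Σ p : Finset.HasAntidiagonal.antidiagonal d, {i // w i = p.1.1} × {j // w' j = p.1.2} :=
    { toFun := fun x => ⟨⟨(w x.1.1, w' x.1.2), by simpa using x.2⟩, ⟨x.1.1, rfl⟩, ⟨x.1.2, rfl⟩⟩
      invFun := fun y => ⟨(y.2.1.1, y.2.2.1), by
        rw [y.2.1.2, y.2.2.2]; exact Finset.HasAntidiagonal.mem_antidiagonal.1 y.1.2⟩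
      left_inv := fun x => rfl
      right_inv := by
        rintro ⟨⟨⟨a, b⟩, h⟩, ⟨i, hi⟩, ⟨j, hj⟩⟩
        obtain rfl : w i = a := hi
        obtain rfl : w' j = b := hj
        rfl }
  rw [Nat.card_congr e, Nat.card_sigma]
  push_cast
  rw [← Finset.sum_coe_sort]
  simp [Nat.card_prod]

theorem finite_fiber_prod {ι κ : Type*} {w : ι → ℕ →₀ ℕ} {w' : κ → ℕ →₀ ℕ}
    (hw : ∀ d, Finite {i // w i = d}) (hw' : ∀ d, Finite {i // w' i = d}) (d : ℕ →₀ ℕ) :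
    Finite {x : ι × κ // w x.1 + w' x.2 = d} := by
  have h1 : {i | w i ≤ d}.Finite :=
    ((Set.finite_Iic d).biUnion fun e _ => (hw e : Set.Finite {i | w i = e})).subset
      fun i hi => Set.mem_biUnion hi rfl
  have h2 : {i | w' i ≤ d}.Finite :=
    ((Set.finite_Iic d).biUnion fun e _ => (hw' e : Set.Finite {i | w' i = e})).subset
      fun i hi => Set.mem_biUnion hi rfl
  exact (h1.prod h2).subset fun x (hx : w x.1 + w' x.2 = d) =>
    ⟨le_self_add.trans hx.le, le_add_self.trans hx.le⟩

theorem monomialSum_sigma_card {ι : Type*} {β : ι → Type*} (w : ι → ℕ →₀ ℕ) (u : ℕ)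
    (h : ∀ i, Finite (β i) ∧ Nat.card (β i) = u) :
    monomialSum (fun x : Σ i, β i => w x.1) = u • monomialSum w := by
  have he : monomialSum (fun x : Σ i, β i => w x.1) = monomialSum fun x : ι × Fin u => w x.1 :=
    monomialSum_congr ((Equiv.sigmaCongrRight fun i =>
      have := (h i).1
      Finite.equivFinOfCardEq (h i).2).trans (Equiv.sigmaEquivProd ι (Fin u))) fun i => rfl
  rw [he]
  ext d
  rw [coeff_monomialSum, map_nsmul, coeff_monomialSum, nsmul_eq_mul]
  have e' : {x : ι × Fin u // w x.1 = d} ≃ Fin u × {i // w i = d} :=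
    ⟨fun x => (x.1.2, ⟨x.1.1, x.2⟩), fun y => ⟨(y.2.1, y.1), y.2.2⟩, fun _ => rfl, fun _ => rfl⟩
  rw [Nat.card_congr e', Nat.card_prod, Nat.card_fin]
  push_cast
  rfl

/-- An identity between indicator functions of index sets gives one between monomial sums. -/
theorem monomialSum_add_eq_add {ι : Type*} {w : ι → ℕ →₀ ℕ} (hw : ∀ d, Finite {i // w i = d})
    {p q r s : ι → Prop}
    (h : ∀ i, p i ∧ q i ∧ r i ∧ s i ∨ ¬ p i ∧ ¬ q i ∧ ¬ r i ∧ ¬ s i ∨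
      (p i ∧ ¬ q i ∨ ¬ p i ∧ q i) ∧ (r i ∧ ¬ s i ∨ ¬ r i ∧ s i)) :
    monomialSum (fun i : {i // p i} => w i) + monomialSum (fun i : {i // q i} => w i) =
      monomialSum (fun i : {i // r i} => w i) + monomialSum (fun i : {i // s i} => w i) := by
  classical
  ext d
  have hd : {i | w i = d}.Finite := hw d
  simp only [map_add, coeff_monomialSum_subtype hd, ← Finset.sum_add_distrib]
  refine Finset.sum_congr rfl fun i _ => ?_
  rcases h i with h | h | ⟨h | h, h' | h'⟩ <;> simp [h] <;> simp [h']

/-! ### Words without equal neighbours -/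

/-- The exponent of the monomial of a word. -/
noncomputable def wordWeight (v : List ℕ) : ℕ →₀ ℕ := Multiset.toFinsupp (v : Multiset ℕ)

theorem wordWeight_nil : wordWeight [] = 0 := by simp [wordWeight]

theorem wordWeight_append (u v : List ℕ) : wordWeight (u ++ v) = wordWeight u + wordWeight v := by
  simp [wordWeight, ← Multiset.coe_add]

theorem wordWeight_reverse (u : List ℕ) : wordWeight u.reverse = wordWeight u := by
  simp [wordWeight]

theorem wordWeight_cons (a : ℕ) (v : List ℕ) :
    wordWeight (a :: v) = Finsupp.single a 1 + wordWeight v := by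
  rw [wordWeight, ← Multiset.cons_coe, ← Multiset.singleton_add, map_add,
    Multiset.toFinsupp_singleton, wordWeight]

theorem finite_word_of_weight (d : ℕ →₀ ℕ) : Finite {v : List ℕ // wordWeight v = d} := by
  refine ((List.permutations (Finsupp.toMultiset d).toList).finite_toSet).subset fun v hv => ?_
  have hv : wordWeight v = d := hv
  simp only [Set.mem_ofPred_eq, List.mem_permutations, ← Multiset.coe_eq_coe, Multiset.coe_toList,
    ← hv, wordWeight, Multiset.toFinsupp_toMultiset]

/-- The sum of the monomials of the words that satisfy `p`. -/
noncomputable def wordSum (p : List ℕ → Prop) : MvPowerSeries ℕ ℚ :=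
  monomialSum fun v : {v // p v} => wordWeight v

/-- The sum of the monomials of the words of length `n` without equal neighbours. -/
noncomputable def pathSum (n : ℕ) : MvPowerSeries ℕ ℚ :=
  wordSum fun v => v.length = n ∧ v.IsChain (· ≠ ·)

/-- The sum of the monomials of the words of length `n` without equal neighbours whose first letter
differs from the `m`-th one. -/
noncomputable def lassoSum (m n : ℕ) : MvPowerSeries ℕ ℚ :=
  wordSum fun v => v.length = n ∧ v.IsChain (· ≠ ·) ∧ v[0]? ≠ v[m - 1]?

/-- The sum of the monomials of the words of length `n` without equal neighbours whose first letter
differs from the `m`-th and the `(m + 1)`-st one. -/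
noncomputable def doubleLassoSum (m n : ℕ) : MvPowerSeries ℕ ℚ :=
  wordSum fun v => v.length = n ∧ v.IsChain (· ≠ ·) ∧ v[0]? ≠ v[m - 1]? ∧ v[0]? ≠ v[m]?

theorem pathSum_zero : pathSum 0 = 1 := by
  have : Unique {v : List ℕ // v.length = 0 ∧ v.IsChain (· ≠ ·)} :=
    ⟨⟨⟨[], by simp⟩⟩, fun x => Subtype.ext (List.length_eq_zero_iff.1 x.2.1)⟩
  rw [pathSum, wordSum, monomialSum_unique]
  have h : (default : {v : List ℕ // v.length = 0 ∧ v.IsChain (· ≠ ·)}).1 = [] :=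
    List.length_eq_zero_iff.1 (default : {v : List ℕ // v.length = 0 ∧ v.IsChain (· ≠ ·)}).2.1
  rw [h, wordWeight_nil]
  rfl

theorem lassoSum_one (n : ℕ) : lassoSum 1 n = 0 := by
  have : IsEmpty {v : List ℕ // v.length = n ∧ v.IsChain (· ≠ ·) ∧ v[0]? ≠ v[1 - 1]?} :=
    ⟨fun x => x.2.2.2 rfl⟩
  exact monomialSum_of_isEmpty _

/-- The sum over pairs of words of lengths `m` and `l`, both without equal neighbours, that
satisfy `q`. -/
noncomputable def wordPairSum (m l : ℕ) (q : List ℕ × List ℕ → Prop) : MvPowerSeries ℕ ℚ :=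
  monomialSum fun x : {x : List ℕ × List ℕ // (x.1.length = m ∧ x.2.length = l ∧
    x.1.IsChain (· ≠ ·) ∧ x.2.IsChain (· ≠ ·)) ∧ q x} => wordWeight x.1.1 + wordWeight x.1.2

theorem wordPairSum_eq_wordSum (m l : ℕ) {q : List ℕ × List ℕ → Prop} {p : List ℕ → Prop}
    (h : ∀ u v : List ℕ, u.length = m → v.length = l →
      ((u.IsChain (· ≠ ·) ∧ v.IsChain (· ≠ ·)) ∧ q (u, v) ↔ p (u ++ v))) :
    wordPairSum m l q = wordSum fun w => w.length = m + l ∧ p w := by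
  refine monomialSum_congr
    { toFun := fun x => ⟨x.1.1 ++ x.1.2, by simp [x.2.1.1, x.2.1.2.1],
        (h _ _ x.2.1.1 x.2.1.2.1).1 ⟨x.2.1.2.2, x.2.2⟩⟩
      invFun := fun w => ⟨(w.1.take m, w.1.drop m), ?_⟩
      left_inv := fun x => ?_
      right_inv := fun w => ?_ } fun x => ?_
  · have h1 : (w.1.take m).length = m := by simp [w.2.1]
    have h2 : (w.1.drop m).length = l := by simp [w.2.1]
    have h3 := (h _ _ h1 h2).2 (by rw [List.take_append_drop]; exact w.2.2)
    exact ⟨⟨h1, h2, h3.1⟩, h3.2⟩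
  · apply Subtype.ext
    have h1 := x.2.1.1
    ext1 <;> simp [← h1]
  · exact Subtype.ext (List.take_append_drop _ _)
  · exact wordWeight_append _ _

/-- Reversing the first word keeps its weight and the chain condition but exchanges its first and
last letters. -/
theorem wordPairSum_reverse (m l : ℕ) (q : List ℕ × List ℕ → Prop) :
    wordPairSum m l (fun x => q (x.1.reverse, x.2)) = wordPairSum m l q := by
  have hrev : ∀ {u : List ℕ}, u.IsChain (· ≠ ·) → u.reverse.IsChain (· ≠ ·) := fun hu =>
    List.isChain_reverse.2 (hu.imp fun _ _ h => h.symm)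
  refine monomialSum_congr
    { toFun := fun x => ⟨(x.1.1.reverse, x.1.2), ⟨by simp [x.2.1.1], x.2.1.2.1,
        hrev x.2.1.2.2.1, x.2.1.2.2.2⟩, x.2.2⟩
      invFun := fun x => ⟨(x.1.1.reverse, x.1.2), ⟨by simp [x.2.1.1], x.2.1.2.1,
        hrev x.2.1.2.2.1, x.2.1.2.2.2⟩, by simpa using x.2.2⟩
      left_inv := fun x => by simp
      right_inv := fun x => by simp } fun x => ?_
  simp [wordWeight_reverse]

/-! ### Cutting a word after its m-th letter -/

section Pairs

variable {u v : List ℕ}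

theorem getElem?_append_zero (hu : u ≠ []) : (u ++ v)[0]? = u.head? := by
  cases u <;> simp_all

theorem getElem?_append_length_sub_one (hu : u ≠ []) :
    (u ++ v)[u.length - 1]? = u.getLast? := by
  rw [List.getElem?_append_left (Nat.sub_one_lt (by simpa using hu)), List.getLast?_eq_getElem?]

theorem getElem?_append_length : (u ++ v)[u.length]? = v.head? := by
  rw [List.getElem?_append_right le_rfl, Nat.sub_self, List.head?_eq_getElem?]

/-- When `v` is empty, `v.head?` is `none` while `u.getLast?` is not, so the condition at the
junction is vacuous and l = 0 needs no separate treatment. -/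
theorem isChain_ne_append_iff (hu : u ≠ []) :
    (u ++ v).IsChain (· ≠ ·) ↔
      (u.IsChain (· ≠ ·) ∧ v.IsChain (· ≠ ·)) ∧ u.getLast? ≠ v.head? := by
  rw [List.isChain_append, and_assoc]
  refine and_congr_right fun _ => and_congr_right fun _ => ?_
  obtain ⟨x, hx⟩ := Option.ne_none_iff_exists'.1 (by simpa using hu : u.getLast? ≠ none)
  rw [hx]
  cases h : v.head? <;> simp

variable {m l : ℕ}

theorem pathSum_eq_wordPairSum (hm : 1 ≤ m) :
    pathSum (m + l) = wordPairSum m l fun x => x.1.getLast? ≠ x.2.head? := by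
  rw [wordPairSum_eq_wordSum (p := fun w => w.IsChain (· ≠ ·))]
  · rfl
  · rintro u v rfl rfl
    rw [isChain_ne_append_iff (by rintro rfl; simp at hm)]

/-- The path may equally be glued at the other end of its first piece; this form is the one matching
the lasso recursion. -/
theorem pathSum_eq_wordPairSum_reverse (hm : 1 ≤ m) :
    pathSum (m + l) = wordPairSum m l fun x => x.1.head? ≠ x.2.head? := by
  rw [pathSum_eq_wordPairSum hm, ← wordPairSum_reverse]
  simp

theorem lassoSum_eq_wordPairSum (hm : 1 ≤ m) :
    lassoSum m (m + l) =
      wordPairSum m l fun x => x.1.getLast? ≠ x.2.head? ∧ x.1.head? ≠ x.1.getLast? := by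
  rw [wordPairSum_eq_wordSum (p := fun w => w.IsChain (· ≠ ·) ∧ w[0]? ≠ w[m - 1]?)]
  · rfl
  · rintro u v rfl rfl
    have hu : u ≠ [] := by rintro rfl; simp at hm
    rw [isChain_ne_append_iff hu, getElem?_append_zero hu, getElem?_append_length_sub_one hu]
    tauto

theorem lassoSum_succ_eq_wordPairSum (hm : 1 ≤ m) :
    lassoSum (m + 1) (m + l) =
      wordPairSum m l fun x => x.1.getLast? ≠ x.2.head? ∧ x.1.head? ≠ x.2.head? := by
  rw [wordPairSum_eq_wordSum (p := fun w => w.IsChain (· ≠ ·) ∧ w[0]? ≠ w[m]?)]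
  · rfl
  · rintro u v rfl rfl
    have hu : u ≠ [] := by rintro rfl; simp at hm
    rw [isChain_ne_append_iff hu, getElem?_append_zero hu, getElem?_append_length]
    tauto

theorem doubleLassoSum_eq_wordPairSum (hm : 1 ≤ m) :
    doubleLassoSum m (m + l) = wordPairSum m l fun x => x.1.getLast? ≠ x.2.head? ∧
      x.1.head? ≠ x.1.getLast? ∧ x.1.head? ≠ x.2.head? := by
  rw [wordPairSum_eq_wordSum
    (p := fun w => w.IsChain (· ≠ ·) ∧ w[0]? ≠ w[m - 1]? ∧ w[0]? ≠ w[m]?)]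
  · rfl
  · rintro u v rfl rfl
    have hu : u ≠ [] := by rintro rfl; simp at hm
    rw [isChain_ne_append_iff hu, getElem?_append_zero hu, getElem?_append_length_sub_one hu,
      getElem?_append_length]
    tauto

/-- A lasso with no tail is a cycle; the product imposes no condition between the two words. -/
theorem lassoSum_mul_pathSum (hm : 1 ≤ m) :
    lassoSum m m * pathSum l = wordPairSum m l fun x => x.1.head? ≠ x.1.getLast? := by
  have hf (p : List ℕ → Prop) (d : ℕ →₀ ℕ) : Finite {v : {v // p v} // wordWeight v = d} :=
    finite_fiber_comp finite_word_of_weight Subtype.val_injective d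
  rw [lassoSum, pathSum, wordSum, wordSum, monomialSum_mul (hf _) (hf _)]
  have key : ∀ u : List ℕ, u.length = m → (u[0]? ≠ u[m - 1]? ↔ u.head? ≠ u.getLast?) := by
    rintro u rfl
    rw [List.getLast?_eq_getElem?, List.head?_eq_getElem?]
  refine monomialSum_congr
    { toFun := fun x => ⟨(x.1.1, x.2.1), ⟨x.1.2.1, x.2.2.1, x.1.2.2.1, x.2.2.2⟩,
        (key _ x.1.2.1).1 x.1.2.2.2⟩
      invFun := fun x => (⟨x.1.1, x.2.1.1, x.2.1.2.2.1, (key _ x.2.1.1).2 x.2.2⟩,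
        ⟨x.1.2, x.2.1.2.1, x.2.1.2.2.2⟩)
      left_inv := fun _ => rfl
      right_inv := fun _ => rfl } fun _ => rfl

theorem wordPairSum_add_eq_add {p q r s : List ℕ × List ℕ → Prop}
    (h : ∀ i, p i ∧ q i ∧ r i ∧ s i ∨ ¬ p i ∧ ¬ q i ∧ ¬ r i ∧ ¬ s i ∨
      (p i ∧ ¬ q i ∨ ¬ p i ∧ q i) ∧ (r i ∧ ¬ s i ∨ ¬ r i ∧ s i)) :
    wordPairSum m l p + wordPairSum m l q = wordPairSum m l r + wordPairSum m l s := by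
  refine monomialSum_add_eq_add
    (finite_fiber_prod finite_word_of_weight finite_word_of_weight) fun i => ?_
  by_cases hi : i.1.length = m ∧ i.2.length = l ∧ i.1.IsChain (· ≠ ·) ∧ i.2.IsChain (· ≠ ·)
  · simpa only [hi, true_and] using h i
  · simp only [hi, false_and, not_false_eq_true, true_and, true_or, or_true]

/-- Let a, b be the first and last letters of the first word and c the head of the second. The claim
is [a≠b][b≠c] + [a≠c] = [b≠c][a≠c] + [a≠b], true for each pattern of equalities among a, b, c. -/
theorem lassoSum_add_pathSum (hm : 1 ≤ m) :
    lassoSum m (m + l) + pathSum (m + l) =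
      lassoSum (m + 1) (m + l) + lassoSum m m * pathSum l := by
  rw [lassoSum_eq_wordPairSum hm, pathSum_eq_wordPairSum_reverse hm,
    lassoSum_succ_eq_wordPairSum hm, lassoSum_mul_pathSum hm]
  refine wordPairSum_add_eq_add fun x => ?_
  grind

/-- If b ≠ c then a equals at most one of them, so [a≠b][a≠c] + 1 = [a≠b] + [a≠c]. -/
theorem doubleLassoSum_add_pathSum (hm : 1 ≤ m) :
    doubleLassoSum m (m + l) + pathSum (m + l) =
      lassoSum m (m + l) + lassoSum (m + 1) (m + l) := by
  rw [doubleLassoSum_eq_wordPairSum hm, pathSum_eq_wordPairSum hm,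
    lassoSum_eq_wordPairSum hm, lassoSum_succ_eq_wordPairSum hm]
  refine wordPairSum_add_eq_add fun x => ?_
  grind

end Pairs

/-! ### The recursion for words without equal neighbours -/

/-- The exponent of the squarefree monomial of a finite set of variables. -/
noncomputable def setWeight (s : Finset ℕ) : ℕ →₀ ℕ := ∑ i ∈ s, Finsupp.single i 1

theorem setWeight_injective : Function.Injective setWeight := by
  classical
  have key : ∀ (s : Finset ℕ) (j : ℕ), j ∈ s ↔ setWeight s j ≠ 0 := fun s j => by
    simp [setWeight, Finsupp.finsetSum_apply, Finsupp.single_apply]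
  intro s t h
  ext j
  rw [key, key, h]

theorem finite_set_of_weight (d : ℕ →₀ ℕ) : Finite {s : Finset ℕ // setWeight s = d} :=
  have : Subsingleton {s : Finset ℕ // setWeight s = d} :=
    ⟨fun a b => Subtype.ext (setWeight_injective (a.2.trans b.2.symm))⟩
  inferInstance

/-- A finite set of letters and a word without equal neighbours, of total size `n`. -/
def IsSetWordPair (n : ℕ) (x : Finset ℕ × List ℕ) : Prop :=
  x.1.card + x.2.length = n ∧ x.2.IsChain (· ≠ ·)

theorem elementarySymmetric_mul_pathSum (n : ℕ) (p : ℕ × ℕ) (hp : p.1 + p.2 = n) :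
    elementarySymmetric p.1 * pathSum p.2 = monomialSum
      fun x : {x : {x // IsSetWordPair n x} // (x.1.1.card, x.1.2.length) = p} =>
        setWeight x.1.1.1 + wordWeight x.1.1.2 := by
  rw [show elementarySymmetric p.1 = monomialSum
      fun s : {s : Finset ℕ // s.card = p.1} => setWeight s from rfl, pathSum, wordSum,
    monomialSum_mul (fun d => finite_fiber_comp finite_set_of_weight Subtype.val_injective d)
    (fun d => finite_fiber_comp finite_word_of_weight Subtype.val_injective d)]
  exact monomialSum_congr
    { toFun := fun x => ⟨⟨(x.1.1, x.2.1), by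
        rw [IsSetWordPair, x.1.2, x.2.2.1]; exact ⟨hp, x.2.2.2⟩⟩, Prod.ext x.1.2 x.2.2.1⟩
      invFun := fun x => (⟨x.1.1.1, congrArg Prod.fst x.2⟩,
        ⟨x.1.1.2, congrArg Prod.snd x.2, x.1.2.2⟩)
      left_inv := fun _ => rfl
      right_inv := fun _ => rfl } fun _ => rfl

theorem finite_setWordPair_of_weight (n : ℕ) (d : ℕ →₀ ℕ) :
    Finite {x : {x // IsSetWordPair n x} // setWeight x.1.1 + wordWeight x.1.2 = d} :=
  finite_fiber_comp (w := fun x : Finset ℕ × List ℕ => setWeight x.1 + wordWeight x.2)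
    (finite_fiber_prod finite_set_of_weight finite_word_of_weight) Subtype.val_injective d

theorem sum_elementarySymmetric_mul_pathSum (n : ℕ) :
    ∑ p ∈ Finset.HasAntidiagonal.antidiagonal n, elementarySymmetric p.1 * pathSum p.2 =
      monomialSum fun x : {x // IsSetWordPair n x} => setWeight x.1.1 + wordWeight x.1.2 := by
  rw [monomialSum_eq_sum_fiber (finite_setWordPair_of_weight n)
    (fun x => (x.1.1.card, x.1.2.length)) (Finset.HasAntidiagonal.antidiagonal n)
    fun x => Finset.HasAntidiagonal.mem_antidiagonal.2 x.2.1]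
  exact Finset.sum_congr rfl fun p hp =>
    elementarySymmetric_mul_pathSum n p (Finset.HasAntidiagonal.mem_antidiagonal.1 hp)

/-- The factor `p.1` counts the ways to mark an element of the set. -/
theorem sum_nsmul_elementarySymmetric_mul_pathSum (n : ℕ) :
    ∑ p ∈ Finset.HasAntidiagonal.antidiagonal n,
      p.1 • (elementarySymmetric p.1 * pathSum p.2) =
      monomialSum fun x : (Σ x : {x // IsSetWordPair n x}, {i // i ∈ x.1.1}) =>
        setWeight x.1.1.1 + wordWeight x.1.1.2 := by
  have hfin (d : ℕ →₀ ℕ) : Finite {x : (Σ x : {x // IsSetWordPair n x}, {i // i ∈ x.1.1}) //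
      setWeight x.1.1.1 + wordWeight x.1.1.2 = d} := by
    have := finite_setWordPair_of_weight n d
    refine Finite.of_injective (β := Σ x : {x : {x // IsSetWordPair n x} //
      setWeight x.1.1 + wordWeight x.1.2 = d}, {i // i ∈ x.1.1.1})
      (fun x => ⟨⟨x.1.1, x.2⟩, x.1.2⟩) ?_
    rintro ⟨⟨x, i⟩, h⟩ ⟨⟨y, j⟩, h'⟩ H
    simp only [Sigma.mk.injEq, Subtype.mk.injEq] at H
    obtain ⟨rfl, H⟩ := H
    obtain rfl := eq_of_heq H
    rfl
  rw [monomialSum_eq_sum_fiber hfin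
    (fun x => (x.1.1.1.card, x.1.1.2.length)) (Finset.HasAntidiagonal.antidiagonal n)
    fun x => Finset.HasAntidiagonal.mem_antidiagonal.2 x.1.2.1]
  refine Finset.sum_congr rfl fun p hp => ?_
  rw [elementarySymmetric_mul_pathSum n p (Finset.HasAntidiagonal.mem_antidiagonal.1 hp),
    ← monomialSum_sigma_card (β := fun x => {i // i ∈ x.1.1.1}) _ p.1
      fun x => ⟨inferInstance, by rw [Nat.card_eq_finsetCard]; exact congrArg Prod.fst x.2⟩]
  exact monomialSum_congr
    { toFun := fun x => ⟨⟨x.1.1, x.2⟩, x.1.2⟩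
      invFun := fun x => ⟨⟨x.1.1, x.2⟩, x.1.2⟩
      left_inv := fun _ => rfl
      right_inv := fun _ => rfl } fun _ => rfl

/-- Moving the first letter of the word into the set, unless it is there already. -/
theorem monomialSum_setWordPair_cons (n : ℕ) :
    monomialSum (fun x : {x : {x // IsSetWordPair n x} // x.1.2 ≠ []} =>
        setWeight x.1.1.1 + wordWeight x.1.1.2) =
      monomialSum fun x : (Σ x : {x // IsSetWordPair n x}, {i // i ∈ x.1.1}) =>
        setWeight x.1.1.1 + wordWeight x.1.1.2 := by
  classical
  have ins (s : Finset ℕ) (i : ℕ) (h : i ∉ s) :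
      setWeight (insert i s) = Finsupp.single i 1 + setWeight s := Finset.sum_insert h
  have ext' (x y : Σ x : {x // IsSetWordPair n x}, {i // i ∈ x.1.1}) (h : x.1.1 = y.1.1)
      (h' : x.2.1 = y.2.1) : x = y := by
    obtain ⟨⟨x, hx⟩, i, hi⟩ := x
    obtain ⟨⟨y, hy⟩, j, hj⟩ := y
    obtain rfl : x = y := h
    obtain rfl : i = j := h'
    rfl
  -- The moved letter becomes the mark. The two cases can be told apart afterwards: the word starts
  -- with the mark exactly if the letter was already in the set, since otherwise the next letter
  -- differs from the one removed.
  refine monomialSum_congr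
    { toFun := fun x => ⟨⟨(insert (x.1.1.2.head x.2) x.1.1.1,
          if x.1.1.2.head x.2 ∈ x.1.1.1 then x.1.1.2 else x.1.1.2.tail), ?_⟩,
        x.1.1.2.head x.2, Finset.mem_insert_self _ _⟩
      invFun := fun x => ⟨⟨(if x.1.1.2.head? = some x.2.1 then x.1.1.1 else x.1.1.1.erase x.2.1,
        if x.1.1.2.head? = some x.2.1 then x.1.1.2 else x.2.1 :: x.1.1.2), ?_⟩, ?_⟩
      left_inv := ?_
      right_inv := ?_ } ?_
  · have h1 := x.1.2.1
    have h2 := List.length_pos_of_ne_nil x.2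
    by_cases h : x.1.1.2.head x.2 ∈ x.1.1.1
    · simpa [h] using x.1.2
    · simp only [h, if_false]
      refine ⟨?_, x.1.2.2.tail⟩
      simp only [Finset.card_insert_of_notMem h, List.length_tail]
      omega
  · have h1 := x.1.2.1
    have h2 := Finset.card_erase_add_one x.2.2
    by_cases h : x.1.1.2.head? = some x.2.1
    · simpa only [h, if_true] using x.1.2
    · simp only [h, if_false]
      refine ⟨by simp only [List.length_cons]; omega, List.isChain_cons.2 ⟨?_, x.1.2.2⟩⟩
      rintro y hy rfl
      exact h hy
  · dsimp only
    split_ifs with h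
    · rintro h0
      simp [h0] at h
    · simp
  · rintro ⟨⟨⟨s, v⟩, hx⟩, hv⟩
    obtain ⟨a, v, rfl⟩ := List.exists_cons_of_ne_nil hv
    by_cases ha : a ∈ s
    · simp [ha]
    · have h1 : v.head? ≠ some a := fun h => (List.isChain_cons.1 hx.2).1 a h rfl
      simp [ha, h1]
  · rintro ⟨⟨⟨s, v⟩, hx⟩, i, hi⟩
    have hi : i ∈ s := hi
    by_cases h : v.head? = some i
    · obtain ⟨v, rfl⟩ : ∃ w, v = i :: w := by
        cases v <;> simp_all
      refine ext' _ _ ?_ ?_ <;> simp [hi]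
    · refine ext' _ _ ?_ ?_ <;> simp [h, Finset.insert_erase hi]
  · have key (s : Finset ℕ) (v : List ℕ) (hv : v ≠ []) :
        setWeight (insert (v.head hv) s) + wordWeight (if v.head hv ∈ s then v else v.tail) =
          setWeight s + wordWeight v := by
      obtain ⟨a, v, rfl⟩ := List.exists_cons_of_ne_nil hv
      by_cases ha : a ∈ s
      · simp [ha]
      · rw [List.head_cons, ins s a ha, wordWeight_cons, if_neg ha, List.tail_cons]
        abel
    exact fun x => key _ _ x.2

/-- Pairs with empty word contribute e_n; those with nonempty word correspond to pairs with a marked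
set element. -/
theorem sum_elementarySymmetric_mul_pathSum_eq (n : ℕ) :
    ∑ p ∈ Finset.HasAntidiagonal.antidiagonal n, elementarySymmetric p.1 * pathSum p.2 =
      elementarySymmetric n + ∑ p ∈ Finset.HasAntidiagonal.antidiagonal n,
        p.1 • (elementarySymmetric p.1 * pathSum p.2) := by
  classical
  rw [sum_nsmul_elementarySymmetric_mul_pathSum, ← monomialSum_setWordPair_cons,
    sum_elementarySymmetric_mul_pathSum]
  have h := monomialSum_eq_sum_fiber (finite_setWordPair_of_weight n)
    (fun x => decide (x.1.2 ≠ [])) Finset.univ fun _ => Finset.mem_univ _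
  rw [h, Fintype.sum_bool, add_comm]
  congr 1
  · refine monomialSum_congr
      { toFun := fun x => ⟨x.1.1.1, ?_⟩
        invFun := fun s => ⟨⟨(s.1, []), by simp [IsSetWordPair, s.2]⟩, by simp⟩
        left_inv := fun x => ?_
        right_inv := fun s => rfl } fun x => ?_
    · have h1 : x.1.1.2 = [] := by simpa using x.2
      simpa [h1] using x.1.2.1
    · have h1 : x.1.1.2 = [] := by simpa using x.2
      exact Subtype.ext (Subtype.ext (Prod.ext rfl h1.symm))
    · have h1 : x.1.1.2 = [] := by simpa using x.2
      simp [h1, wordWeight_nil, setWeight]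
  · exact monomialSum_congr (Equiv.subtypeEquivRight fun x => by simp) fun _ => rfl

/-! ### A positive formula for the double lasso -/

section PositiveFormula

open Finset.HasAntidiagonal

variable {A : Type*} [CommRing A] (e : ℕ → A)

/-- The coefficients of the power series inverse to `1 - ∑ (k - 1) e_k z ^ k`. -/
def compositionSum : ℕ → A
  | 0 => 1
  | n + 1 => ∑ i : Fin (n + 1), (i : ℕ) * e (i + 1) * compositionSum (n - i)
  decreasing_by omega

/-- The sum over the compositions of `a + r` into a composition counted by `P` and a last part that
is at least `r`. -/
def straddleSum (P : ℕ → A) (a r : ℕ) : A :=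
  ∑ p ∈ antidiagonal a, ((p.1 + r : ℕ) - 1) * e (p.1 + r) * P p.2 + e (a + r)

/-- The closed formula for lassos with a loop of length `m` and a tail of length `l`. -/
def lassoFormula (P : ℕ → A) (l m : ℕ) : A :=
  ∑ p ∈ antidiagonal m, ((p.1 : A) - 1) * straddleSum e P l p.1 * compositionSum e p.2

variable {e}

/-- This is the defining recursion of `compositionSum`, whose left-hand side is the term with first
index 0, as (0-1) e_0 = -1. -/
theorem sum_mul_compositionSum (he : e 0 = 1) (n : ℕ) :
    ∑ p ∈ antidiagonal n, ((p.1 : A) - 1) * e p.1 * compositionSum e p.2 =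
      if n = 0 then -1 else 0 := by
  cases n with
  | zero => simp [he, compositionSum]
  | succ n =>
    rw [Finset.Nat.sum_antidiagonal_succ, Finset.Nat.sum_antidiagonal_eq_sum_range_succ_mk,
      compositionSum, Finset.sum_range]
    simp [he]

/-- The term with `p.1 = 0` splits off; in the others one unit passes from the summation index to
`r`. -/
theorem straddleSum_succ (P : ℕ → A) (a r : ℕ) :
    straddleSum e P (a + 1) r = straddleSum e P a (r + 1) + P (a + 1) * ((r - 1) * e r) := by
  rw [straddleSum, straddleSum, Finset.Nat.sum_antidiagonal_succ]
  have h : ∀ k, k + 1 + r = k + (r + 1) := fun k => by ring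
  simp only [h, zero_add]
  ring

variable {P : ℕ → A} (he : e 0 = 1) (hP0 : P 0 = 1)
  (hP : ∀ n, ∑ p ∈ antidiagonal n, e p.1 * P p.2 =
    e n + ∑ p ∈ antidiagonal n, p.1 • (e p.1 * P p.2))

include hP in
-- For r = 0 this is the path recursion `hP` rearranged.
theorem straddleSum_zero_right (a : ℕ) : straddleSum e P a 0 = 0 := by
  have h : ∑ p ∈ antidiagonal a, ((p.1 : A) - 1) * e p.1 * P p.2 =
      ∑ p ∈ antidiagonal a, p.1 • (e p.1 * P p.2) - ∑ p ∈ antidiagonal a, e p.1 * P p.2 := by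
    rw [← Finset.sum_sub_distrib]
    exact Finset.sum_congr rfl fun p _ => by rw [nsmul_eq_mul]; ring
  simp only [straddleSum, add_zero, h, hP]
  ring

include hP0 in
theorem straddleSum_zero_left (r : ℕ) : straddleSum e P 0 r = r * e r := by
  simp [straddleSum, hP0]
  ring

include he hP in
-- With F = ∑ (k-1) e_k z^k, k = 0 included, the recursions say F·P = -E and F·K = -1; eliminating F
-- gives P = E·K.
theorem path_eq_sum_mul_compositionSum (n : ℕ) :
    P n = ∑ p ∈ antidiagonal n, e p.1 * compositionSum e p.2 := by
  have h1 : (PowerSeries.mk fun k => ((k : A) - 1) * e k) * PowerSeries.mk P =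
      -PowerSeries.mk e := by
    ext n
    have := straddleSum_zero_right hP n
    simp only [straddleSum, add_zero] at this
    simp only [PowerSeries.coeff_mul, PowerSeries.coeff_mk, map_neg]
    exact eq_neg_of_add_eq_zero_left this
  have h2 : (PowerSeries.mk fun k => ((k : A) - 1) * e k) *
      PowerSeries.mk (compositionSum e) = -1 := by
    ext n
    simp only [PowerSeries.coeff_mul, PowerSeries.coeff_mk, map_neg, PowerSeries.coeff_one]
    rw [sum_mul_compositionSum he]
    split_ifs <;> simp
  have h3 : PowerSeries.mk P = PowerSeries.mk e * PowerSeries.mk (compositionSum e) := by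
    linear_combination PowerSeries.mk P * h2 - PowerSeries.mk (compositionSum e) * h1
  have h4 := congrArg (PowerSeries.coeff n) h3
  simpa only [PowerSeries.coeff_mul, PowerSeries.coeff_mk] using h4

include he hP0 hP in
-- Raising l changes S(l, r+1) into S(l+1, r) by a multiple of (r-1) e_r, which sums to zero against
-- K; the term r = 0 of the previous sum vanishes. For l = 0 the same zero sum turns e_r into r e_r.
theorem path_eq_sum_straddleSum (l m : ℕ) :
    P (l + (m + 1)) =
      ∑ p ∈ antidiagonal (m + 1), straddleSum e P l p.1 * compositionSum e p.2 := by
  induction l generalizing m with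
  | zero =>
    have h := sum_mul_compositionSum he (m + 1)
    rw [zero_add, path_eq_sum_mul_compositionSum he hP, ← add_zero (Finset.sum _ _),
      ← (if_neg (Nat.succ_ne_zero m) : (if m + 1 = 0 then (-1 : A) else 0) = 0), ← h,
      ← Finset.sum_add_distrib]
    refine Finset.sum_congr rfl fun p _ => ?_
    rw [straddleSum_zero_left hP0]
    ring
  | succ l ih =>
    have h := sum_mul_compositionSum he (m + 1)
    rw [if_neg (Nat.succ_ne_zero m)] at h
    have h2 := ih (m + 1)
    rw [Finset.Nat.sum_antidiagonal_succ, straddleSum_zero_right hP, zero_mul, zero_add] at h2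
    rw [show l + 1 + (m + 1) = l + (m + 1 + 1) by ring, h2,
      ← add_zero (Finset.sum _ _), ← mul_zero (P (l + 1)), ← h, Finset.mul_sum,
      ← Finset.sum_add_distrib]
    refine Finset.sum_congr rfl fun p _ => ?_
    rw [straddleSum_succ P]
    ring

include hP0 in
theorem lassoFormula_zero (m : ℕ) :
    lassoFormula e P 0 m =
      ∑ p ∈ antidiagonal m, (p.1 : A) * (((p.1 : A) - 1) * e p.1 * compositionSum e p.2) := by
  refine Finset.sum_congr rfl fun p _ => ?_
  rw [straddleSum_zero_left hP0]
  ring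

include he hP0 hP in
-- Once P is expanded in straddle sums and the zero sum ∑ (r-1) e_r K_t is subtracted, this holds
-- term by term, using r(r-1) - (r-1) = (r-1)².
theorem lassoFormula_succ (l m : ℕ) :
    lassoFormula e P (l + 1) (m + 1) + P (m + 1 + (l + 1)) =
      lassoFormula e P l (m + 2) + lassoFormula e P 0 (m + 1) * P (l + 1) := by
  have h1 := path_eq_sum_straddleSum he hP0 hP l (m + 1)
  rw [Finset.Nat.sum_antidiagonal_succ, straddleSum_zero_right hP, zero_mul, zero_add] at h1
  have h := sum_mul_compositionSum he (m + 1)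
  rw [if_neg (Nat.succ_ne_zero m)] at h
  rw [show m + 1 + (l + 1) = l + (m + 1 + 1) by ring, h1, lassoFormula_zero hP0,
    ← sub_zero (Finset.sum _ _ * P _), ← zero_mul (P (l + 1)), ← h, ← sub_mul,
    ← Finset.sum_sub_distrib, Finset.sum_mul, lassoFormula, lassoFormula,
    Finset.Nat.sum_antidiagonal_succ (n := m + 1), straddleSum_zero_right hP,
    mul_zero, zero_mul, zero_add, ← Finset.sum_add_distrib, ← Finset.sum_add_distrib]
  refine Finset.sum_congr rfl fun p _ => ?_
  rw [straddleSum_succ P]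
  push_cast
  ring

include hP in
theorem lassoFormula_one (l : ℕ) : lassoFormula e P l 1 = 0 := by
  simp [lassoFormula, Finset.Nat.antidiagonal_succ, straddleSum_zero_right hP]

include he hP0 hP in
/-- The lasso recursion has a unique solution. -/
theorem lasso_eq_lassoFormula {T : ℕ → ℕ → A} (hT1 : ∀ n, T 1 n = 0)
    (hT : ∀ m l, 1 ≤ m → T m (m + l) + P (m + l) = T (m + 1) (m + l) + T m m * P l) (m l : ℕ) :
    T (m + 1) (m + 1 + l) = lassoFormula e P l (m + 1) := by
  -- The recursion lengthens the loop at fixed total size; the cycle term it brings in has smaller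
  -- total size, whence the outer induction.
  induction hn : m + l using Nat.strong_induction_on generalizing m l with
  | _ n ih =>
    induction m generalizing l with
    | zero => rw [zero_add, hT1, lassoFormula_one hP]
    | succ m ihm =>
      have h1 := ihm (l + 1) (by omega)
      have h2 := ih m (by omega) m 0 rfl
      have h3 := hT (m + 1) (l + 1) (by omega)
      have h4 := lassoFormula_succ he hP0 hP l m
      rw [add_zero] at h2
      rw [h1, h2] at h3
      rw [show m + 1 + 1 + l = m + 1 + (l + 1) by ring]
      linear_combination h4 - h3

variable {S : Subsemiring A} (hS : ∀ k, e k ∈ S)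

include hS in
theorem compositionSum_mem (n : ℕ) : compositionSum e n ∈ S := by
  induction n using Nat.strong_induction_on with
  | _ n ih =>
    cases n with
    | zero => rw [compositionSum]; exact S.one_mem
    | succ n =>
      rw [compositionSum]
      exact S.sum_mem fun i _ =>
        S.mul_mem (S.mul_mem (natCast_mem S _) (hS _)) (ih _ (by omega))

include he hP hS in
-- With the second index positive, the coefficients p + r + 1 - 1 are natural numbers.
theorem straddleSum_mem (l r : ℕ) : straddleSum e P l (r + 1) ∈ S := by
  refine S.add_mem (S.sum_mem fun p _ => S.mul_mem (S.mul_mem ?_ (hS _)) ?_) (hS _)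
  · rw [← add_assoc, Nat.cast_succ, add_sub_cancel_right]
    exact natCast_mem S _
  · rw [path_eq_sum_mul_compositionSum he hP]
    exact S.sum_mem fun q _ => S.mul_mem (hS _) (compositionSum_mem hS _)

include he hP0 hP hS in
-- Positivity holds for each r. The terms r = 0, 1 vanish; for r ≥ 2, peeling (r-1) e_r P off the
-- straddle sum leaves 2(r-1) S(l, r+1) + (r-1)(r-2) e_r P, because 2(r-1) - r = r-2.
theorem two_mul_lassoFormula_sub_mem (l m : ℕ) :
    2 * lassoFormula e P (l + 1) m - lassoFormula e P 0 m * P (l + 1) ∈ S := by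
  rw [lassoFormula_zero hP0, lassoFormula, Finset.mul_sum, Finset.sum_mul,
    ← Finset.sum_sub_distrib]
  refine S.sum_mem fun p _ => ?_
  obtain ⟨r, t⟩ := p
  have hPS : P (l + 1) ∈ S := by
    rw [path_eq_sum_mul_compositionSum he hP]
    exact S.sum_mem fun q _ => S.mul_mem (hS _) (compositionSum_mem hS _)
  rcases r with _ | _ | r
  · simp [straddleSum_zero_right hP]
  · simp
  · have h : 2 * ((((r + 1 + 1 : ℕ) : A) - 1) * straddleSum e P (l + 1) (r + 1 + 1) *
        compositionSum e t) - ((r + 1 + 1 : ℕ) : A) * ((((r + 1 + 1 : ℕ) : A) - 1) *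
          e (r + 1 + 1) * compositionSum e t) * P (l + 1) =
        ((2 * (r + 1) : ℕ) * straddleSum e P l (r + 2 + 1) +
          ((r + 1) * r : ℕ) * (P (l + 1) * e (r + 2))) * compositionSum e t := by
      rw [straddleSum_succ P]
      push_cast
      ring
    rw [h]
    exact S.mul_mem (S.add_mem (S.mul_mem (natCast_mem S _) (straddleSum_mem he hP hS _ _))
      (S.mul_mem (natCast_mem S _) (S.mul_mem hPS (hS _)))) (compositionSum_mem hS _)

end PositiveFormula

/-! ### Positivity of the double lasso in the e_k -/

theorem elementarySymmetric_zero : elementarySymmetric 0 = 1 := by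
  have : Unique {s : Finset ℕ // s.card = 0} :=
    ⟨⟨⟨∅, rfl⟩⟩, fun x => Subtype.ext (Finset.card_eq_zero.1 x.2)⟩
  rw [elementarySymmetric, monomialSum_unique]
  have h : (default : {s : Finset ℕ // s.card = 0}).1 = ∅ :=
    Finset.card_eq_zero.1 (default : {s : Finset ℕ // s.card = 0}).2
  rw [h, Finset.sum_empty]
  rfl

/-- Eliminating L(m+1) between the two word identities gives D = 2L(m) - C_m P_l. -/
theorem doubleLassoSum_mem_closure (m l : ℕ) (hm : 1 ≤ m) (hl : 1 ≤ l) :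
    doubleLassoSum m (m + l) ∈ Subsemiring.closure (Set.range elementarySymmetric) := by
  obtain ⟨m, rfl⟩ := Nat.exists_eq_add_of_le' hm
  obtain ⟨l, rfl⟩ := Nat.exists_eq_add_of_le' hl
  have hT := lasso_eq_lassoFormula elementarySymmetric_zero pathSum_zero
    sum_elementarySymmetric_mul_pathSum_eq lassoSum_one fun m l => lassoSum_add_pathSum (l := l)
  have h := two_mul_lassoFormula_sub_mem elementarySymmetric_zero pathSum_zero
    sum_elementarySymmetric_mul_pathSum_eq (S := Subsemiring.closure (Set.range elementarySymmetric))
    (fun k => Subsemiring.subset_closure ⟨k, rfl⟩) l (m + 1)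
  rw [← hT m, ← hT m, add_zero] at h
  convert h using 1
  have h1 := doubleLassoSum_add_pathSum (l := l + 1) hm
  have h2 := lassoSum_add_pathSum (l := l + 1) hm
  linear_combination h1 - h2

/-! ### The line graph of a tadpole -/

theorem wordWeight_ofFn {n : ℕ} (g : Fin n → ℕ) :
    wordWeight (List.ofFn g) = ∑ i, Finsupp.single (g i) 1 := by
  induction n with
  | zero => simp [wordWeight_nil]
  | succ n ih => rw [List.ofFn_succ, wordWeight_cons, ih, Fin.sum_univ_succ]

theorem chromaticSymmetricFunction_eq_wordSum {V : Type*} [Finite V] (G : SimpleGraph V) {n : ℕ}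
    (f : Fin n ≃ V) {p : List ℕ → Prop}
    (h : ∀ κ : Fin n → ℕ, (∀ i j, G.Adj (f i) (f j) → κ i ≠ κ j) ↔ p (List.ofFn κ)) :
    chromaticSymmetricFunction G = wordSum fun v => v.length = n ∧ p v := by
  have hv {v : List ℕ} (hv : v.length = n) : List.ofFn (fun i : Fin n => v[i]) = v := by
    subst hv
    exact List.ofFn_getElem
  refine monomialSum_congr
    { toFun := fun κ => ⟨List.ofFn fun i => κ (f i), List.length_ofFn,
        (h _).1 fun i j hij => κ.valid hij⟩
      invFun := fun v => SimpleGraph.Coloring.mk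
        (fun x => v.1[(f.symm x : ℕ)]'(by rw [v.2.1]; exact (f.symm x).2)) fun {x y} hxy => ?_
      left_inv := fun κ => ?_
      right_inv := fun v => ?_ } fun κ => ?_
  · refine (h fun i => v.1[(i : ℕ)]'(by rw [v.2.1]; exact i.2)).2 ?_ _ _ (by simpa using hxy)
    have := hv v.2.1
    simp only [Fin.getElem_fin] at this
    rw [this]
    exact v.2.2
  · ext x
    simp [SimpleGraph.Coloring.mk]
  · apply Subtype.ext
    simpa [SimpleGraph.Coloring.mk] using hv v.2.1
  · have := Fintype.ofFinite V
    change wordWeight (List.ofFn fun i => κ (f i)) = _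
    rw [wordWeight_ofFn, coloringWeight, finsum_eq_sum_of_fintype]
    exact f.sum_comp fun x => Finsupp.single (κ x) 1

namespace SimpleGraph

/-- Orienting the cycle of a tadpole around and its tail towards the cycle, with vertices numbered
along the cycle and then along the tail, every vertex has exactly one successor. -/
def tadpoleSucc (m i : ℕ) : ℕ := if i + 1 < m then i + 1 else if i ≤ m then 0 else i - 1

theorem tadpoleSucc_spec (m i : ℕ) : i + 1 < m ∧ tadpoleSucc m i = i + 1 ∨
    m ≤ i + 1 ∧ i ≤ m ∧ tadpoleSucc m i = 0 ∨ m < i ∧ tadpoleSucc m i + 1 = i := by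
  unfold tadpoleSucc
  split_ifs <;> omega

theorem tadpole_adj_iff {m l : ℕ} (hm : 3 ≤ m) (a b : Fin m ⊕ Fin l) :
    (tadpole m l).Adj a b ↔
      tadpoleSucc m (finSumFinEquiv a) = finSumFinEquiv b ∨
        tadpoleSucc m (finSumFinEquiv b) = finSumFinEquiv a := by
  rcases a with ⟨i, hi⟩ | ⟨i, hi⟩ <;> rcases b with ⟨j, hj⟩ | ⟨j, hj⟩ <;>
    simp only [tadpole, sup_adj, sum_adj_inl, sum_adj_inr, fromRel_adj, cycleGraph_adj',
      pathGraph_adj, finSumFinEquiv_apply_left, finSumFinEquiv_apply_right, Fin.val_castAdd,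
      Fin.val_natAdd, Fin.sub_def]
  · have key : ∀ x y, x < m → y < m → ((m - y + x) % m = 1 ↔ x = y + 1 ∨ x = 0 ∧ y + 1 = m) := by
      intro x y hx hy
      rcases lt_or_ge x y with h | h
      · rw [Nat.mod_eq_of_lt (by omega)]
        omega
      · rw [show m - y + x = x - y + m by omega, Nat.add_mod_right, Nat.mod_eq_of_lt (by omega)]
        omega
    simp only [key i j hi hj, key j i hj hi]
    have h1 := tadpoleSucc_spec m i
    have h2 := tadpoleSucc_spec m j
    simp
    omega
  · have h1 := tadpoleSucc_spec m i
    have h2 := tadpoleSucc_spec m (m + j)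
    simp
    omega
  · have h1 := tadpoleSucc_spec m (m + i)
    have h2 := tadpoleSucc_spec m j
    simp
    omega
  · have h1 := tadpoleSucc_spec m (m + i)
    have h2 := tadpoleSucc_spec m (m + j)
    simp
    omega

theorem tadpoleSucc_lt {m l i : ℕ} (hi : i < m + l) : tadpoleSucc m i < m + l := by
  have := tadpoleSucc_spec m i
  omega

variable {m l : ℕ}

/-- The edge of a tadpole that joins the `i`-th vertex to its successor. -/
def tadpoleEdge (hm : 3 ≤ m) (i : Fin (m + l)) : (tadpole m l).edgeSet :=
  ⟨s(finSumFinEquiv.symm i, finSumFinEquiv.symm ⟨tadpoleSucc m i, tadpoleSucc_lt i.2⟩), by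
    rw [mem_edgeSet, tadpole_adj_iff hm]
    simp⟩

/-- Each edge is the outgoing edge of exactly one of its ends: the successor map has no 2-cycle, as
m ≥ 3. -/
theorem tadpoleEdge_bijective (hm : 3 ≤ m) : Function.Bijective (tadpoleEdge (l := l) hm) := by
  constructor
  · intro i j h
    have h := congrArg Subtype.val h
    simp only [tadpoleEdge, Sym2.eq_iff, EmbeddingLike.apply_eq_iff_eq, Fin.ext_iff] at h
    rcases h with h | h
    · exact Fin.ext h.1
    · obtain ⟨h1, h2⟩ := h
      have h3 := tadpoleSucc_spec m i
      have h4 := tadpoleSucc_spec m j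
      omega
  · rintro ⟨e, he⟩
    induction e using Sym2.ind with
    | _ a b =>
      rw [mem_edgeSet, tadpole_adj_iff hm] at he
      rcases he with he | he
      · refine ⟨finSumFinEquiv a, Subtype.ext ?_⟩
        simp [tadpoleEdge, he]
      · refine ⟨finSumFinEquiv b, Subtype.ext ?_⟩
        simp [tadpoleEdge, he]

/-- The only distinct vertices with a common successor are m-1 and m, both leading to 0; they are
consecutive, so this adds no adjacency beyond those of 0. -/
theorem lineGraph_tadpole_adj_iff (hm : 3 ≤ m) (i j : Fin (m + l)) :
    (tadpole m l).lineGraph.Adj (tadpoleEdge hm i) (tadpoleEdge hm j) ↔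
      (i : ℕ) + 1 = j ∨ (j : ℕ) + 1 = i ∨ ((i : ℕ) = 0 ∧ ((j : ℕ) = m - 1 ∨ (j : ℕ) = m)) ∨
        ((j : ℕ) = 0 ∧ ((i : ℕ) = m - 1 ∨ (i : ℕ) = m)) := by
  rw [lineGraph_adj_iff_exists, ne_eq, (tadpoleEdge_bijective hm).1.eq_iff, Fin.ext_iff]
  have h : (∃ v, v ∈ (tadpoleEdge hm i : Sym2 (Fin m ⊕ Fin l)) ∧
      v ∈ (tadpoleEdge hm j : Sym2 (Fin m ⊕ Fin l))) ↔ (i : ℕ) = j ∨ (i : ℕ) = tadpoleSucc m j ∨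
        tadpoleSucc m i = j ∨ tadpoleSucc m i = tadpoleSucc m j := by
    simp [tadpoleEdge, Fin.ext_iff, or_assoc, or_and_right, exists_or]
  have h3 := tadpoleSucc_spec m i
  have h4 := tadpoleSucc_spec m j
  rw [h]
  omega

theorem chromaticSymmetricFunction_lineGraph_tadpole (hm : 3 ≤ m) (hl : 1 ≤ l) :
    chromaticSymmetricFunction (tadpole m l).lineGraph = doubleLassoSum m (m + l) := by
  refine chromaticSymmetricFunction_eq_wordSum _
    (Equiv.ofBijective _ (tadpoleEdge_bijective hm)) fun κ => ?_
  simp only [Equiv.ofBijective_apply, lineGraph_tadpole_adj_iff]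
  rw [List.isChain_iff_getElem]
  simp only [List.getElem_ofFn, List.length_ofFn, List.getElem?_ofFn]
  rw [dif_pos (by omega), dif_pos (by omega), dif_pos (by omega)]
  simp only [ne_eq, Option.some.injEq]
  constructor
  · intro h
    refine ⟨fun i hi => h _ _ (Or.inl rfl), h _ _ ?_, h _ _ ?_⟩ <;> simp
  · rintro ⟨h1, h2, h3⟩ ⟨i, hi⟩ ⟨j, hj⟩ (h | h | ⟨h, h' | h'⟩ | ⟨h, h' | h'⟩) <;>
      simp only at h <;> (try simp only at h') <;> subst h <;> (try subst h')
    · exact h1 _ hj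
    · exact fun h => h1 _ hi h.symm
    · exact h2
    · exact h3
    · exact fun h => h2 h.symm
    · exact fun h => h3 h.symm

/-! ### Line graphs are claw-free -/

/-- Each of three leaves contains an end of the central edge, so two of them share an end and are
adjacent. -/
theorem isClawFree_lineGraph {V : Type*} (G : SimpleGraph V) : G.lineGraph.IsClawFree := by
  rintro ⟨f⟩
  have hadj (i : Fin 3) : G.lineGraph.Adj (f (Sum.inl 0)) (f (Sum.inr i)) :=
    f.map_rel_iff.2 (by simp)
  have hnot (i j : Fin 3) : ¬ G.lineGraph.Adj (f (Sum.inr i)) (f (Sum.inr j)) := fun h => by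
    simpa using f.map_rel_iff.1 h
  have hne {i j : Fin 3} (h : i ≠ j) : f (Sum.inr i) ≠ f (Sum.inr j) := fun h' =>
    h (Sum.inr_injective (f.injective h'))
  obtain ⟨⟨e, he⟩, hfe⟩ : ∃ e, f (Sum.inl 0) = e := ⟨_, rfl⟩
  induction e using Sym2.ind with
  | _ a b =>
    have hmem (i : Fin 3) : a ∈ (f (Sum.inr i)).1 ∨ b ∈ (f (Sum.inr i)).1 := by
      obtain ⟨-, v, hv, hv'⟩ := lineGraph_adj_iff_exists.1 (hadj i)
      rw [hfe] at hv
      rcases Sym2.mem_iff.1 hv with rfl | rfl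
      · exact Or.inl hv'
      · exact Or.inr hv'
    have hcommon {i j : Fin 3} (h : i ≠ j) (v : V) (hi : v ∈ (f (Sum.inr i)).1) :
        v ∉ (f (Sum.inr j)).1 := fun hj =>
      hnot i j (lineGraph_adj_iff_exists.2 ⟨hne h, v, hi, hj⟩)
    have h01 := hcommon (i := 0) (j := 1) (by decide)
    have h02 := hcommon (i := 0) (j := 2) (by decide)
    have h12 := hcommon (i := 1) (j := 2) (by decide)
    rcases hmem 0 with h0 | h0 <;> rcases hmem 1 with h1 | h1 <;> rcases hmem 2 with h2 | h2
    all_goals first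
      | exact h01 _ h0 h1
      | exact h02 _ h0 h2
      | exact h12 _ h1 h2

end SimpleGraph

/-! ### Sums over Gelfand–Tsetlin patterns and the dual Pieri rule -/

section GelfandTsetlin

variable {R : Type*} [CommRing R]

/-- The sum over the Gelfand–Tsetlin patterns with top row `μ`. -/
def gelfandTsetlinSum (x : ℕ → R) : (N : ℕ) → (Fin N → ℕ) → R
  | 0, _ => 1
  | N + 1, μ => x N ^ μ (Fin.last N) *
      ∑ κ ∈ Fintype.piFinset fun i : Fin N => Finset.Icc (μ i.succ) (μ i.castSucc),
        (∏ i, x N ^ (μ i.castSucc - κ i)) * gelfandTsetlinSum x N κ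

theorem map_gelfandTsetlinSum {S : Type*} [CommRing S] (φ : R →+* S) (x : ℕ → R) (N : ℕ)
    (μ : Fin N → ℕ) :
    φ (gelfandTsetlinSum x N μ) = gelfandTsetlinSum (fun i => φ (x i)) N μ := by
  induction N with
  | zero => simp [gelfandTsetlinSum]
  | succ N ih => simp [gelfandTsetlinSum, ih]

/-- No row interlaces with a row that fails to decrease. Sums may therefore run over boxes of
arbitrary tuples. -/
theorem gelfandTsetlinSum_eq_zero (x : ℕ → R) {N : ℕ} {μ : Fin N → ℕ} (hμ : ¬ Antitone μ) :
    gelfandTsetlinSum x N μ = 0 := by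
  cases N with
  | zero => exact absurd (fun i => i.elim0) hμ
  | succ N =>
    rw [Fin.antitone_iff_succ_le] at hμ
    push Not at hμ
    obtain ⟨i, hi⟩ := hμ
    have h : Fintype.piFinset (fun i : Fin N => Finset.Icc (μ i.succ) (μ i.castSucc)) = ∅ :=
      Fintype.piFinset_eq_empty.2 ⟨i, Finset.Icc_eq_empty (by omega)⟩
    rw [gelfandTsetlinSum, h, Finset.sum_empty, mul_zero]

/-- The contributions of one row to the two sides of the commutation relation between adding a
vertical strip and removing a horizontal strip. -/
theorem row_commutation (x y : R) {p' p c b : ℕ} (hp : p' ≤ p) (hc : c ≤ b) :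
    (∑ a ∈ Finset.Icc p (p + 1) with c ≤ a ∧ a ≤ b, y ^ (a - p) * x ^ (a - c)) *
        ((if p' ≤ c then 1 else 0) + x * y * if p' < c then 1 else 0) =
      ((if p ≤ b then 1 else 0) + x * y * if p < b then 1 else 0) *
        ∑ a ∈ Finset.Icc p' p with a ≤ c ∧ c ≤ a + 1, x ^ (p - a) * y ^ (c - a) := by
  have h1 : Finset.Icc p (p + 1) = {p, p + 1} := by
    ext a
    simp only [Finset.mem_Icc, Finset.mem_insert, Finset.mem_singleton]
    omega
  -- Only a = c and a = c - 1 survive the filter.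
  have h2 : (∑ a ∈ Finset.Icc p' p with a ≤ c ∧ c ≤ a + 1, x ^ (p - a) * y ^ (c - a)) =
      (if p' ≤ c ∧ c ≤ p then x ^ (p - c) else 0) +
        if p' < c ∧ c ≤ p + 1 then x ^ (p + 1 - c) * y else 0 := by
    -- The guard `0 < c` keeps the truncated `c - 1` from counting a = 0 when c = 0.
    have h3 : ∀ a ∈ Finset.Icc p' p, (if a ≤ c ∧ c ≤ a + 1 then x ^ (p - a) * y ^ (c - a) else 0) =
        (if a = c then x ^ (p - c) else 0) +
          if a = c - 1 then (if 0 < c then x ^ (p + 1 - c) * y else 0) else 0 := by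
      intro a ha
      rcases c with _ | c
      · simp only [nonpos_iff_eq_zero, zero_le, and_true, lt_irrefl, if_false, ite_self, add_zero]
        split_ifs with h
        · simp [h]
        · rfl
      · rcases eq_or_ne a (c + 1) with rfl | h
        · simp
        · rcases eq_or_ne a c with rfl | h'
          · simp
          · rw [if_neg (by omega), if_neg h, if_neg (by omega), add_zero]
    rw [Finset.sum_filter, Finset.sum_congr rfl h3, Finset.sum_add_distrib, Finset.sum_ite_eq',
      Finset.sum_ite_eq']
    congr 1
    · simp
    · rw [← ite_and]
      refine if_congr ?_ rfl rfl
      rw [Finset.mem_Icc]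
      omega
  rw [Finset.sum_filter, h1, Finset.sum_pair (by omega), h2]
  rcases le_or_gt c p with h | h
  · rw [show p + 1 - c = p - c + 1 by omega]
    simp only [h, true_and, le_add_right h, and_true, Nat.succ_le_iff, Nat.sub_self, pow_zero,
      add_tsub_cancel_left, pow_one]
    split_ifs <;> ring
  · rcases eq_or_ne c (p + 1) with rfl | h'
    · rw [if_neg (by omega), if_pos (by omega), if_pos (by omega), if_pos (by omega),
        if_pos (by omega), if_pos (by omega), if_neg (by omega), if_pos (by omega)]
      simp [mul_comm]
    · rw [if_neg (by omega), if_neg (by omega), if_neg (by omega : ¬ (p' ≤ c ∧ c ≤ p)),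
        if_neg (by omega : ¬ (p' < c ∧ c ≤ p + 1))]
      simp

/-- The local relations let `D` be passed along the product, each step turning one `L` into an `E`.
-/
theorem prod_telescope {N : ℕ} (L D : Fin (N + 1) → R) (E : Fin N → R)
    (h : ∀ i : Fin N, L i.castSucc * D i.succ = D i.castSucc * E i) :
    (∏ i : Fin N, L i.castSucc) * D (Fin.last N) = D 0 * ∏ i, E i := by
  induction N with
  | zero => simp
  | succ N ih =>
    have h1 := ih (fun i => L i.castSucc) (fun i => D i.castSucc) (fun i => E i.castSucc)
      fun i => h i.castSucc
    have h2 := h (Fin.last N)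
    rw [Fin.succ_last] at h2
    rw [Fin.prod_univ_castSucc, mul_assoc, h2, ← mul_assoc, h1, Fin.prod_univ_castSucc E,
      ← mul_assoc]
    rfl

/-- The commutation relation between adding a vertical strip and removing a horizontal strip. -/
theorem strip_commutation (x y : R) {N : ℕ} {μ : Fin (N + 1) → ℕ} (hμ : Antitone μ)
    {ρ : Fin N → ℕ} (hρ : Antitone ρ) :
    ∑ ν ∈ Fintype.piFinset fun i : Fin (N + 1) => {a ∈ Finset.Icc (μ i) (μ i + 1) |
        (Fin.snoc ρ 0 : Fin (N + 1) → ℕ) i ≤ a ∧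
          a ≤ (Fin.cons (max (μ 0 + 1) (if h : 0 < N then ρ ⟨0, h⟩ else 0)) ρ :
            Fin (N + 1) → ℕ) i},
      ∏ i, (y ^ (ν i - μ i) * x ^ (ν i - (Fin.snoc ρ 0 : Fin (N + 1) → ℕ) i)) =
    (1 + x * y) * (x ^ μ (Fin.last N) *
      ∑ κ ∈ Fintype.piFinset fun i : Fin N =>
        {a ∈ Finset.Icc (μ i.succ) (μ i.castSucc) | a ≤ ρ i ∧ ρ i ≤ a + 1},
      ∏ i, (x ^ (μ i.castSucc - κ i) * y ^ (ρ i - κ i))) := by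
  -- `B i` bounds ν_i from above by ρ_{i-1}. Row 0 has no such bound; its value exceeds μ_0, so that
  -- the bound is vacuous and the boundary factor is 1 + xy, and is at least ρ_0, as the row
  -- relation needs.
  set B : Fin (N + 1) → ℕ :=
    Fin.cons (max (μ 0 + 1) (if h : 0 < N then ρ ⟨0, h⟩ else 0)) ρ with hB
  -- Given ρ, the conditions on ν and on κ are independent row by row, so both sums factor.
  rw [← Finset.prod_univ_sum _ fun i a =>
      y ^ (a - μ i) * x ^ (a - (Fin.snoc ρ 0 : Fin (N + 1) → ℕ) i),
    ← Finset.prod_univ_sum _ fun i a => x ^ (μ i.castSucc - a) * y ^ (ρ i - a)]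
  have hρB : ∀ i : Fin N, ρ i ≤ B i.castSucc := by
    cases N with
    | zero => exact fun i => i.elim0
    | succ N =>
      intro i
      refine Fin.cases ?_ (fun j => ?_) i
      · simp [hB]
      · rw [← Fin.succ_castSucc, hB, Fin.cons_succ]
        exact hρ (Fin.castSucc_le_succ j)
  have h := prod_telescope
    (fun i => ∑ a ∈ Finset.Icc (μ i) (μ i + 1) with
        (Fin.snoc ρ 0 : Fin (N + 1) → ℕ) i ≤ a ∧ a ≤ B i,
      y ^ (a - μ i) * x ^ (a - (Fin.snoc ρ 0 : Fin (N + 1) → ℕ) i))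
    (fun i => (if μ i ≤ B i then 1 else 0) + x * y * if μ i < B i then 1 else 0)
    (fun i => ∑ a ∈ Finset.Icc (μ i.succ) (μ i.castSucc) with a ≤ ρ i ∧ ρ i ≤ a + 1,
      x ^ (μ i.castSucc - a) * y ^ (ρ i - a)) fun i => by
        have hBi : B i.succ = ρ i := by rw [hB, Fin.cons_succ]
        simp only [Fin.snoc_castSucc, hBi]
        exact row_commutation x y (hμ (Fin.castSucc_le_succ i)) (hρB i)
  have h0 : μ 0 < B 0 := by simp [hB]
  simp only [h0, h0.le, if_true, mul_one] at h
  rw [Fin.prod_univ_castSucc, mul_left_comm, ← h, mul_left_comm, mul_comm (x ^ _)]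
  rw [mul_assoc]
  congr 1
  -- The last row, bounded below only by 0, equals x^μ_N times the final boundary factor of the
  -- telescoping.
  have h1 : Finset.Icc (μ (Fin.last N)) (μ (Fin.last N) + 1) =
      {μ (Fin.last N), μ (Fin.last N) + 1} := by
    ext a
    simp only [Finset.mem_Icc, Finset.mem_insert, Finset.mem_singleton]
    omega
  rw [Finset.sum_filter, h1, Finset.sum_pair (by omega)]
  simp only [Fin.snoc_last, zero_le, true_and, Nat.succ_le_iff, Nat.sub_self, pow_zero,
    add_tsub_cancel_left, pow_one, Nat.sub_zero]
  split_ifs <;> ring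

/-- The dual Pieri rule in finitely many variables. -/
theorem prod_mul_gelfandTsetlinSum (x : ℕ → R) (y : R) {N : ℕ} {μ : Fin N → ℕ}
    (hμ : Antitone μ) :
    (∏ i ∈ Finset.range N, (1 + x i * y)) * gelfandTsetlinSum x N μ =
      ∑ ν ∈ Fintype.piFinset fun i => Finset.Icc (μ i) (μ i + 1),
        (∏ i, y ^ (ν i - μ i)) * gelfandTsetlinSum x N ν := by
  induction N with
  | zero => simp [gelfandTsetlinSum]
  | succ N ih =>
    have hκ : ∀ κ ∈ Fintype.piFinset fun i : Fin N => Finset.Icc (μ i.succ) (μ i.castSucc),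
        Antitone κ := by
      intro κ hκ
      rw [Fintype.mem_piFinset] at hκ
      intro i j hij
      rcases hij.eq_or_lt with rfl | h
      · rfl
      · exact (Finset.mem_Icc.1 (hκ j)).2.trans
          ((hμ (by simpa [Fin.le_def] using h)).trans (Finset.mem_Icc.1 (hκ i)).1)
    -- Removing a horizontal strip to κ, then adding a vertical strip by induction, grouped by the
    -- resulting ρ.
    have hL : (∏ i ∈ Finset.range (N + 1), (1 + x i * y)) * gelfandTsetlinSum x (N + 1) μ =
        ∑ ρ ∈ Fintype.piFinset fun i : Fin N => Finset.Icc 0 (μ i.castSucc + 1),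
          ((1 + x N * y) * (x N ^ μ (Fin.last N) *
            ∑ κ ∈ Fintype.piFinset fun i : Fin N =>
              {a ∈ Finset.Icc (μ i.succ) (μ i.castSucc) | a ≤ ρ i ∧ ρ i ≤ a + 1},
            ∏ i, (x N ^ (μ i.castSucc - κ i) * y ^ (ρ i - κ i)))) *
              gelfandTsetlinSum x N ρ := by
      simp only [Finset.mul_sum, Finset.sum_mul]
      rw [Finset.sum_comm' (t' := Fintype.piFinset fun i : Fin N =>
        Finset.Icc (μ i.succ) (μ i.castSucc)) (s' := fun κ => Fintype.piFinset fun i =>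
          Finset.Icc (κ i) (κ i + 1))]
      · rw [gelfandTsetlinSum, Finset.mul_sum, Finset.mul_sum]
        refine Finset.sum_congr rfl fun κ h => ?_
        rw [Finset.prod_range_succ]
        calc _ = (1 + x N * y) * (x N ^ μ (Fin.last N) * ((∏ i, x N ^ (μ i.castSucc - κ i)) *
              ((∏ i ∈ Finset.range N, (1 + x i * y)) * gelfandTsetlinSum x N κ))) := by ring
          _ = _ := by
            rw [ih (hκ κ h), Finset.mul_sum, Finset.mul_sum, Finset.mul_sum]
            refine Finset.sum_congr rfl fun ρ _ => ?_
            rw [Finset.prod_mul_distrib]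
            ring
      · intro ρ κ
        simp only [Fintype.mem_piFinset, Finset.mem_filter, Finset.mem_Icc]
        constructor
        · rintro ⟨-, h⟩
          exact ⟨fun i => (h i).2, fun i => (h i).1⟩
        · rintro ⟨h, h'⟩
          exact ⟨fun i => ⟨by omega, by have := h i; have := h' i; omega⟩, fun i => ⟨h' i, h i⟩⟩
    -- The opposite order: add the vertical strip, then remove a horizontal strip to reach the same
    -- ρ. The box for ρ is merely a common finite index set.
    have hR : ∑ ν ∈ Fintype.piFinset fun i => Finset.Icc (μ i) (μ i + 1),
          (∏ i, y ^ (ν i - μ i)) * gelfandTsetlinSum x (N + 1) ν =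
        ∑ ρ ∈ Fintype.piFinset fun i : Fin N => Finset.Icc 0 (μ i.castSucc + 1),
          (∑ ν ∈ Fintype.piFinset fun i : Fin (N + 1) => {a ∈ Finset.Icc (μ i) (μ i + 1) |
              (Fin.snoc ρ 0 : Fin (N + 1) → ℕ) i ≤ a ∧
                a ≤ (Fin.cons (max (μ 0 + 1) (if h : 0 < N then ρ ⟨0, h⟩ else 0)) ρ :
                  Fin (N + 1) → ℕ) i},
            ∏ i, (y ^ (ν i - μ i) * x N ^ (ν i - (Fin.snoc ρ 0 : Fin (N + 1) → ℕ) i))) *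
              gelfandTsetlinSum x N ρ := by
      simp only [gelfandTsetlinSum, Finset.mul_sum, Finset.sum_mul]
      rw [Finset.sum_comm' (s := Fintype.piFinset fun i => Finset.Icc (μ i) (μ i + 1))
        (t' := Fintype.piFinset fun i : Fin N => Finset.Icc 0 (μ i.castSucc + 1))
        (s' := fun ρ => Fintype.piFinset fun i : Fin (N + 1) => {a ∈ Finset.Icc (μ i) (μ i + 1) |
              (Fin.snoc ρ 0 : Fin (N + 1) → ℕ) i ≤ a ∧
                a ≤ (Fin.cons (max (μ 0 + 1) (if h : 0 < N then ρ ⟨0, h⟩ else 0)) ρ :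
                  Fin (N + 1) → ℕ) i})]
      · refine Finset.sum_congr rfl fun ρ _ => Finset.sum_congr rfl fun ν _ => ?_
        rw [Finset.prod_mul_distrib,
          Fin.prod_univ_castSucc (fun i => x N ^ (ν i - (Fin.snoc ρ 0 : Fin (N + 1) → ℕ) i))]
        simp only [Fin.snoc_castSucc, Fin.snoc_last, Nat.sub_zero]
        ring
      · intro ν ρ
        simp only [Fintype.mem_piFinset, Finset.mem_filter, Finset.mem_Icc]
        constructor
        · rintro ⟨h, h'⟩
          refine ⟨fun i => ⟨h i, ?_, ?_⟩, fun i => ⟨by omega, ?_⟩⟩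
          · refine Fin.lastCases ?_ (fun j => ?_) i
            · simp
            · rw [Fin.snoc_castSucc]
              exact (h' j).2
          · refine Fin.cases ?_ (fun j => ?_) i
            · rw [Fin.cons_zero]
              exact (h 0).2.trans (le_max_left _ _)
            · rw [Fin.cons_succ]
              exact (h' j).1
          · exact (h' i).2.trans (h _).2
        · rintro ⟨h, -⟩
          refine ⟨fun i => (h i).1, fun i => ⟨?_, ?_⟩⟩
          · have := (h i.succ).2.2
            rwa [Fin.cons_succ] at this
          · have := (h i.castSucc).2.1
            rwa [Fin.snoc_castSucc] at this
    rw [hL, hR]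
    refine Finset.sum_congr rfl fun ρ _ => ?_
    by_cases hρ : Antitone ρ
    · rw [strip_commutation _ _ hμ hρ]
    · rw [gelfandTsetlinSum_eq_zero x hρ, mul_zero, mul_zero]

/-- The coefficient of y^n in the preceding identity over `R[y]`. -/
theorem sum_powersetCard_mul_gelfandTsetlinSum (x : ℕ → R) (n : ℕ) {N : ℕ} {μ : Fin N → ℕ}
    (hμ : Antitone μ) :
    (∑ t ∈ Finset.powersetCard n (Finset.range N), ∏ i ∈ t, x i) * gelfandTsetlinSum x N μ =
      ∑ ν ∈ Fintype.piFinset fun i => Finset.Icc (μ i) (μ i + 1) with ∑ i, (ν i - μ i) = n,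
        gelfandTsetlinSum x N ν := by
  have h := congrArg (fun p => Polynomial.coeff p n)
    (prod_mul_gelfandTsetlinSum (fun i => Polynomial.C (x i)) Polynomial.X hμ)
  simp only [← map_gelfandTsetlinSum, Finset.prod_one_add, Finset.prod_mul_distrib,
    Finset.prod_const, ← map_prod, Polynomial.coeff_mul_C, Polynomial.finsetSum_coeff,
    Polynomial.coeff_C_mul_X_pow, Finset.prod_pow_eq_pow_sum, Polynomial.coeff_X_pow] at h
  rw [← Finset.sum_filter] at h
  simp only [eq_comm (a := n), ← Finset.powersetCard_eq_filter, ite_mul, one_mul, zero_mul] at h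
  rw [h, Finset.sum_filter]

end GelfandTsetlin

/-! ### Semistandard tableaux and Gelfand–Tsetlin patterns -/

/-- Semistandard fillings, with entries below `N`, of a shape with row lengths `μ i`. -/
structure IsTableauFilling (N : ℕ) {M : ℕ} (μ : Fin M → ℕ) (t : Fin M → ℕ → ℕ) : Prop where
  zeros : ∀ i j, μ i ≤ j → t i j = 0
  lt : ∀ i j, j < μ i → t i j < N
  row_weak : ∀ i j₁ j₂, j₁ ≤ j₂ → j₂ < μ i → t i j₁ ≤ t i j₂
  col_strict : ∀ i₁ i₂ j, i₁ < i₂ → j < μ i₂ → t i₁ j < t i₂ j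

/-- The exponent of the monomial of a filling. -/
noncomputable def fillingWeight {M : ℕ} (μ : Fin M → ℕ) (t : Fin M → ℕ → ℕ) : ℕ →₀ ℕ :=
  ∑ i, ∑ j ∈ Finset.range (μ i), Finsupp.single (t i j) 1

theorem finite_tableauFilling (N : ℕ) {M : ℕ} (μ : Fin M → ℕ) :
    Finite {t // IsTableauFilling N μ t} := by
  refine Finite.of_injective (β := (Σ i : Fin M, Fin (μ i)) → Fin N)
    (fun t c => ⟨t.1 c.1 c.2, t.2.lt _ _ c.2.2⟩) fun t t' h => Subtype.ext ?_
  funext i j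
  by_cases hj : j < μ i
  · simpa using congrFun h ⟨i, j, hj⟩
  · rw [t.2.zeros _ _ (not_lt.1 hj), t'.2.zeros _ _ (not_lt.1 hj)]

/-- The shape formed by the entries below `N`. -/
def innerShape {N : ℕ} (μ : Fin (N + 1) → ℕ) (t : Fin (N + 1) → ℕ → ℕ) (i : Fin N) : ℕ :=
  {j ∈ Finset.range (μ i.castSucc) | t i.castSucc j < N}.card

/-- Rows increase weakly, so the entries below N form an initial segment of each row. -/
theorem IsTableauFilling.lt_innerShape_iff {N : ℕ} {μ : Fin (N + 1) → ℕ}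
    {t : Fin (N + 1) → ℕ → ℕ} (ht : IsTableauFilling (N + 1) μ t) (i : Fin N) {j : ℕ} :
    j < innerShape μ t i ↔ j < μ i.castSucc ∧ t i.castSucc j < N := by
  set s := {j ∈ Finset.range (μ i.castSucc) | t i.castSucc j < N} with hs
  have hmem : ∀ j, j ∈ s ↔ j < μ i.castSucc ∧ t i.castSucc j < N := by simp [hs]
  rw [← hmem, innerShape]
  change j < s.card ↔ _
  constructor
  · intro h
    by_contra hj
    have : s ⊆ Finset.range j := fun k hk => by
      rw [Finset.mem_range]
      by_contra hjk
      have h1 := (hmem k).1 hk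
      exact hj ((hmem j).2 ⟨by omega,
        (ht.row_weak _ j k (not_lt.1 hjk) h1.1).trans_lt h1.2⟩)
    simpa using h.trans_le (Finset.card_le_card this)
  · intro h
    have h1 := (hmem j).1 h
    have : Finset.range (j + 1) ⊆ s := fun k hk => by
      rw [Finset.mem_range] at hk
      exact (hmem k).2 ⟨by omega, (ht.row_weak _ k j (by omega) h1.1).trans_lt h1.2⟩
    simpa using Finset.card_le_card this

/-- Columns increase strictly from at least 0. In the last of N+1 rows with entries at most N, all
entries thus equal N, which is why the inner shape needs only N rows. -/
theorem IsTableauFilling.le_apply {N M : ℕ} {μ : Fin M → ℕ}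
    {t : Fin M → ℕ → ℕ} (ht : IsTableauFilling N μ t) (hμ : Antitone μ) (i : Fin M) {j : ℕ}
    (hj : j < μ i) : (i : ℕ) ≤ t i j := by
  obtain ⟨i, hi⟩ := i
  induction i with
  | zero => exact Nat.zero_le _
  | succ i ih =>
    have h1 : (⟨i, by omega⟩ : Fin M) < ⟨i + 1, hi⟩ := by simp
    exact (ih (by omega) (hj.trans_le (hμ h1.le))).trans_lt (ht.col_strict _ _ j h1 hj)

/-- An entry lying above another in its column is smaller than something at most N, hence belongs to
the inner shape; this is the lower interlacing bound. -/
theorem IsTableauFilling.innerShape_mem {N : ℕ} {μ : Fin (N + 1) → ℕ}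
    {t : Fin (N + 1) → ℕ → ℕ} (ht : IsTableauFilling (N + 1) μ t) (hμ : Antitone μ) :
    innerShape μ t ∈
      Fintype.piFinset fun i : Fin N => Finset.Icc (μ i.succ) (μ i.castSucc) := by
  rw [Fintype.mem_piFinset]
  refine fun i => Finset.mem_Icc.2 ⟨?_, ?_⟩
  · by_contra h
    have h1 := ht.lt_innerShape_iff i (j := innerShape μ t i)
    have h2 := ht.col_strict _ _ _ (Fin.castSucc_lt_succ (i := i)) (not_le.1 h)
    have h3 := ht.lt _ _ (not_le.1 h)
    have h4 : μ i.succ ≤ μ i.castSucc := hμ (Fin.castSucc_le_succ i)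
    omega
  · exact (Finset.card_filter_le _ _).trans (by simp)

/-- Extending a filling with entries below `N` by entries equal to `N`. -/
def extendFilling {N : ℕ} (μ : Fin (N + 1) → ℕ) (κ : Fin N → ℕ) (t : Fin N → ℕ → ℕ) :
    Fin (N + 1) → ℕ → ℕ :=
  Fin.snoc (α := fun _ => ℕ → ℕ)
    (fun i j => if j < κ i then t i j else if j < μ i.castSucc then N else 0)
    fun j => if j < μ (Fin.last N) then N else 0

theorem isTableauFilling_extendFilling {N : ℕ} {μ : Fin (N + 1) → ℕ} (hμ : Antitone μ)
    {κ : Fin N → ℕ} (hκ : κ ∈ Fintype.piFinset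
      fun i : Fin N => Finset.Icc (μ i.succ) (μ i.castSucc))
    {t : Fin N → ℕ → ℕ} (ht : IsTableauFilling N κ t) :
    IsTableauFilling (N + 1) μ (extendFilling μ κ t) ∧
      innerShape μ (extendFilling μ κ t) = κ := by
  have hκ' : ∀ i : Fin N, μ i.succ ≤ κ i ∧ κ i ≤ μ i.castSucc := fun i =>
    Finset.mem_Icc.1 (Fintype.mem_piFinset.1 hκ i)
  have hmain : IsTableauFilling (N + 1) μ (extendFilling μ κ t) := by
    refine ⟨fun i j hj => ?_, fun i j hj => ?_, fun i j₁ j₂ h hj => ?_,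
      fun i₁ i₂ j hi hj => ?_⟩
    · cases i using Fin.lastCases with
      | last => simp [extendFilling, hj]
      | cast i =>
        have := hκ' i
        simp only [extendFilling, Fin.snoc_castSucc]
        rw [if_neg (by omega), if_neg (by omega)]
    · cases i using Fin.lastCases with
      | last => simp [extendFilling, hj]
      | cast i =>
        simp only [extendFilling, Fin.snoc_castSucc]
        split_ifs with h1
        · exact (ht.lt _ _ h1).trans (Nat.lt_succ_self N)
        · exact Nat.lt_succ_self N
    · cases i using Fin.lastCases with
      | last =>
        simp only [extendFilling, Fin.snoc_last]
        rw [if_pos (by omega), if_pos hj]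
      | cast i =>
        simp only [extendFilling, Fin.snoc_castSucc]
        rw [if_pos hj, if_pos (by omega : j₁ < μ i.castSucc)]
        split_ifs with h1 h2
        · exact ht.row_weak _ _ _ h h2
        · exact (ht.lt _ _ h1).le
        · omega
        · rfl
    · cases i₁ using Fin.lastCases with
      | last => exact absurd hi (Fin.le_last _).not_gt
      | cast i₁ =>
        have h1 : j < κ i₁ := (hj.trans_le (hμ (by simpa [Fin.le_def, Fin.lt_def] using hi : i₁.succ ≤ i₂))).trans_le (hκ' i₁).1
        simp only [extendFilling, Fin.snoc_castSucc]
        rw [if_pos h1]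
        cases i₂ using Fin.lastCases with
        | last =>
          rw [Fin.snoc_last, if_pos hj]
          exact ht.lt _ _ h1
        | cast i₂ =>
          rw [Fin.snoc_castSucc]
          split_ifs with h2
          · exact ht.col_strict _ _ _ (by simpa using hi) h2
          · exact ht.lt _ _ h1
  refine ⟨hmain, funext fun i => ?_⟩
  refine eq_of_forall_lt_iff fun j => ?_
  rw [hmain.lt_innerShape_iff]
  simp only [extendFilling, Fin.snoc_castSucc]
  have := hκ' i
  constructor
  · rintro ⟨h1, h2⟩
    by_contra h3
    simp [h3, h1] at h2
  · intro h
    rw [if_pos h]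
    exact ⟨by omega, ht.lt _ _ h⟩

theorem fillingWeight_extendFilling {N : ℕ} {μ : Fin (N + 1) → ℕ} {κ : Fin N → ℕ}
    (hκ : κ ∈ Fintype.piFinset fun i : Fin N => Finset.Icc (μ i.succ) (μ i.castSucc))
    (t : Fin N → ℕ → ℕ) :
    fillingWeight μ (extendFilling μ κ t) =
      Finsupp.single N (μ (Fin.last N) + ∑ i, (μ i.castSucc - κ i)) + fillingWeight κ t := by
  have hκ' : ∀ i : Fin N, κ i ≤ μ i.castSucc := fun i =>
    (Finset.mem_Icc.1 (Fintype.mem_piFinset.1 hκ i)).2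
  have hrow (i : Fin N) : ∑ j ∈ Finset.range (μ i.castSucc),
      Finsupp.single (extendFilling μ κ t i.castSucc j) 1 =
        ∑ j ∈ Finset.range (κ i), Finsupp.single (t i j) 1 +
          Finsupp.single N (μ i.castSucc - κ i) := by
    obtain ⟨k, hk⟩ := Nat.exists_eq_add_of_le (hκ' i)
    rw [hk, Finset.sum_range_add, Nat.add_sub_cancel_left]
    congr 1
    · refine Finset.sum_congr rfl fun j hj => ?_
      simp only [extendFilling, Fin.snoc_castSucc]
      rw [if_pos (Finset.mem_range.1 hj)]
    · rw [Finset.sum_congr rfl (g := fun _ => Finsupp.single N 1), Finset.sum_const,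
        Finset.card_range, Finsupp.smul_single, smul_eq_mul, mul_one]
      intro j hj
      have := Finset.mem_range.1 hj
      simp only [extendFilling, Fin.snoc_castSucc]
      rw [if_neg (by omega), if_pos (by omega)]
  have hlast : ∑ j ∈ Finset.range (μ (Fin.last N)),
      Finsupp.single (extendFilling μ κ t (Fin.last N) j) 1 =
        Finsupp.single N (μ (Fin.last N)) := by
    rw [Finset.sum_congr rfl (g := fun _ => Finsupp.single N 1), Finset.sum_const,
      Finset.card_range, Finsupp.smul_single, smul_eq_mul, mul_one]
    intro j hj
    simp only [extendFilling, Fin.snoc_last]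
    rw [if_pos (Finset.mem_range.1 hj)]
  rw [fillingWeight, Fin.sum_univ_castSucc, hlast]
  simp only [hrow]
  rw [Finset.sum_add_distrib, Finsupp.single_add, Finsupp.single_finsetSum, fillingWeight]
  abel

/-- The fillings with a given inner shape are the extensions of the fillings of that shape. -/
def extendFillingEquiv {N : ℕ} {μ : Fin (N + 1) → ℕ} (hμ : Antitone μ) {κ : Fin N → ℕ}
    (hκ : κ ∈ Fintype.piFinset fun i : Fin N => Finset.Icc (μ i.succ) (μ i.castSucc)) :
    {t // IsTableauFilling N κ t} ≃
      {t : {t // IsTableauFilling (N + 1) μ t} // innerShape μ t.1 = κ} where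
  toFun t := ⟨⟨extendFilling μ κ t.1, (isTableauFilling_extendFilling hμ hκ t.2).1⟩,
    (isTableauFilling_extendFilling hμ hκ t.2).2⟩
  invFun t := ⟨fun i j => if j < κ i then t.1.1 i.castSucc j else 0, by
    obtain ⟨⟨t, ht⟩, rfl⟩ := t
    have hlt := fun i j => ht.lt_innerShape_iff i (j := j)
    have hanti : ∀ i₁ i₂ : Fin N, i₁ < i₂ → innerShape μ t i₂ ≤ innerShape μ t i₁ :=
      fun i₁ i₂ hi => by
        have h1 := Finset.mem_Icc.1 (Fintype.mem_piFinset.1 hκ i₁)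
        have h2 := Finset.mem_Icc.1 (Fintype.mem_piFinset.1 hκ i₂)
        exact h2.2.trans ((hμ (by simpa [Fin.le_def] using hi)).trans h1.1)
    refine ⟨fun i j hj => if_neg (not_lt.2 hj), fun i j hj => ?_, fun i j₁ j₂ h hj => ?_,
      fun i₁ i₂ j hi hj => ?_⟩
    · simp only [hj, if_true]
      exact ((hlt i _).1 hj).2
    · simp only [hj, h.trans_lt hj, if_true]
      exact ht.row_weak _ _ _ h ((hlt i _).1 hj).1
    · simp only [hj, hj.trans_le (hanti _ _ hi), if_true]
      exact ht.col_strict _ _ _ (by simpa using hi) ((hlt i₂ _).1 hj).1⟩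
  left_inv t := by
    apply Subtype.ext
    funext i j
    by_cases hj : j < κ i
    · simp [extendFilling, hj]
    · simp [hj, t.2.zeros _ _ (not_lt.1 hj)]
  right_inv t := by
    obtain ⟨⟨t, ht⟩, rfl⟩ := t
    apply Subtype.ext
    apply Subtype.ext
    funext i j
    cases i using Fin.lastCases with
    | last =>
      simp only [extendFilling, Fin.snoc_last]
      split_ifs with hj
      · have h1 := ht.le_apply hμ _ hj
        have h2 := ht.lt _ _ hj
        rw [Fin.val_last] at h1
        omega
      · rw [ht.zeros _ _ (not_lt.1 hj)]
    | cast i =>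
      simp only [extendFilling, Fin.snoc_castSucc]
      have h1 := ht.lt_innerShape_iff i (j := j)
      split_ifs with h2 h3
      · rfl
      · have h4 := ht.lt _ _ h3
        omega
      · rw [ht.zeros _ _ (not_lt.1 h3)]

/-! ### Schur functions as Gelfand–Tsetlin sums -/

theorem X_pow_mul_monomialSum {ι : Type*} {w : ι → ℕ →₀ ℕ} (hw : ∀ d, Finite {i // w i = d})
    (N k : ℕ) : (MvPowerSeries.X N : MvPowerSeries ℕ ℚ) ^ k * monomialSum w =
      monomialSum fun i => Finsupp.single N k + w i := by
  rw [MvPowerSeries.X_pow_eq, ← monomialSum_unique fun _ : Unit => Finsupp.single N k,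
    monomialSum_mul (fun d => inferInstance) hw]
  exact monomialSum_congr (Equiv.punitProd ι) fun _ => rfl

/-- Induction on the number of letters: grouping fillings by the shape left after deleting the
largest letter reproduces the recursion of `gelfandTsetlinSum`. -/
theorem monomialSum_fillingWeight {N : ℕ} {μ : Fin N → ℕ} (hμ : Antitone μ) :
    (monomialSum fun t : {t // IsTableauFilling N μ t} => fillingWeight μ t.1) =
      gelfandTsetlinSum MvPowerSeries.X N μ := by
  induction N with
  | zero =>
    have : Unique {t // IsTableauFilling 0 μ t} :=
      ⟨⟨⟨fun i => i.elim0, ⟨fun i => i.elim0, fun i => i.elim0, fun i => i.elim0,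
        fun i => i.elim0⟩⟩⟩, fun t => Subtype.ext (funext fun i => i.elim0)⟩
    rw [monomialSum_unique, gelfandTsetlinSum, fillingWeight, Finset.univ_eq_empty,
      Finset.sum_empty]
    rfl
  | succ N ih =>
    have := finite_tableauFilling (N + 1) μ
    rw [monomialSum_eq_sum_fiber (fun d => inferInstance)
      (fun t : {t // IsTableauFilling (N + 1) μ t} => innerShape μ t.1) _
      fun t => t.2.innerShape_mem hμ, gelfandTsetlinSum, Finset.mul_sum]
    refine Finset.sum_congr rfl fun κ hκ => ?_
    have hκ' : Antitone κ := by
      intro i j hij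
      rcases hij.eq_or_lt with rfl | h
      · rfl
      · exact (Finset.mem_Icc.1 (Fintype.mem_piFinset.1 hκ j)).2.trans
          ((hμ (by simpa [Fin.le_def] using h)).trans
            (Finset.mem_Icc.1 (Fintype.mem_piFinset.1 hκ i)).1)
    have := finite_tableauFilling N κ
    rw [Finset.prod_pow_eq_pow_sum, ← mul_assoc, ← pow_add, ← ih hκ',
      X_pow_mul_monomialSum fun d => inferInstance]
    exact (monomialSum_congr (extendFillingEquiv hμ hκ) fun t =>
      fillingWeight_extendFilling hκ t.1).symm

theorem YoungDiagram.sum_cells {A : Type*} [AddCommMonoid A] (μ : YoungDiagram) {N : ℕ}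
    (hN : μ.card ≤ N) (f : ℕ → ℕ → A) :
    ∑ c ∈ μ.cells, f c.1 c.2 = ∑ i : Fin N, ∑ j ∈ Finset.range (μ.rowLen i), f i j := by
  rw [Finset.sum_finset_product (γ := ℕ) (α := ℕ) μ.cells (Finset.range N)
    fun i => Finset.range (μ.rowLen i), Finset.sum_range]
  rintro ⟨i, j⟩
  rw [YoungDiagram.mem_cells, Finset.mem_range, Finset.mem_range,
    ← YoungDiagram.mem_iff_lt_rowLen]
  refine ⟨fun h => ⟨?_, h⟩, fun h => h.2⟩
  rw [YoungDiagram.mem_iff_lt_colLen, YoungDiagram.colLen_eq_card] at h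
  exact h.trans_le ((Finset.card_le_card (Finset.filter_subset _ _)).trans hN)

theorem YoungDiagram.rowLen_eq_zero (μ : YoungDiagram) {i : ℕ} (hi : μ.card ≤ i) :
    μ.rowLen i = 0 := by
  by_contra h
  have h := YoungDiagram.mem_iff_lt_rowLen.2 (Nat.pos_of_ne_zero h)
  rw [YoungDiagram.mem_iff_lt_colLen, YoungDiagram.colLen_eq_card] at h
  exact (h.trans_le ((Finset.card_le_card (Finset.filter_subset _ _)).trans hi)).false

theorem YoungDiagram.antitone_rowLen (μ : YoungDiagram) (N : ℕ) :
    Antitone fun i : Fin N => μ.rowLen i := fun i j h => μ.rowLen_anti i j h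

/-- A tableau of weight d uses only letters in the support of d, and a diagram with at most N cells
has at most N rows; so N variables and N rows suffice. -/
theorem coeff_schurFunction (μ : YoungDiagram) {N : ℕ} (hN : μ.card ≤ N) {d : ℕ →₀ ℕ}
    (hd : d.support ⊆ Finset.range N) :
    MvPowerSeries.coeff d (schurFunction μ) =
      MvPowerSeries.coeff d (gelfandTsetlinSum MvPowerSeries.X N fun i => μ.rowLen i) := by
  rw [← monomialSum_fillingWeight (μ.antitone_rowLen N), schurFunction, coeff_monomialSum,
    coeff_monomialSum]
  congr 1
  have hw (T : SemistandardYoungTableau μ) : tableauWeight T =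
      fillingWeight (fun i : Fin N => μ.rowLen i) fun i j => T i j :=
    μ.sum_cells hN fun i j => Finsupp.single (T i j) 1
  have hi {i j : ℕ} (h : (i, j) ∈ μ) : i < N := by
    by_contra h'
    rw [YoungDiagram.mem_iff_lt_rowLen, μ.rowLen_eq_zero (hN.trans (not_lt.1 h'))] at h
    exact absurd h (Nat.not_lt_zero _)
  have hlt (T : SemistandardYoungTableau μ) (hT : tableauWeight T = d) {i j : ℕ}
      (h : (i, j) ∈ μ) : T i j < N := by
    refine Finset.mem_range.1 (hd ?_)
    rw [← hT, tableauWeight, Finsupp.mem_support_iff, Finsupp.finsetSum_apply]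
    refine (Finset.sum_pos' (fun _ _ => Nat.zero_le _) ⟨(i, j), h, ?_⟩).ne'
    simp
  refine Nat.card_congr
    { toFun := fun T => ⟨⟨fun i j => T.1 i j, ?_⟩, ?_⟩
      invFun := fun t => ⟨⟨fun i j => if h : i < N then t.1.1 ⟨i, h⟩ j else 0, ?_, ?_, ?_⟩, ?_⟩
      left_inv := ?_
      right_inv := ?_ }
  · exact ⟨fun i j h => T.1.zeros (by rw [YoungDiagram.mem_iff_lt_rowLen]; omega),
      fun i j h => hlt T.1 T.2 (YoungDiagram.mem_iff_lt_rowLen.2 h),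
      fun i j₁ j₂ h h' => T.1.row_weak_of_le h (YoungDiagram.mem_iff_lt_rowLen.2 h'),
      fun i₁ i₂ j h h' => T.1.col_strict h (YoungDiagram.mem_iff_lt_rowLen.2 h')⟩
  · exact (hw T.1).symm.trans T.2
  · intro i j₁ j₂ h h'
    simp only [hi h', dite_true]
    exact t.1.2.row_weak _ _ _ h.le (YoungDiagram.mem_iff_lt_rowLen.1 h')
  · intro i₁ i₂ j h h'
    simp only [hi h', h.trans (hi h'), dite_true]
    exact t.1.2.col_strict _ _ _ h (YoungDiagram.mem_iff_lt_rowLen.1 h')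
  · intro i j h
    rw [YoungDiagram.mem_iff_lt_rowLen, not_lt] at h
    split_ifs with h'
    · exact t.1.2.zeros _ _ h
    · rfl
  · rw [hw]
    simp only [← t.2]
    congr 1
    funext i j
    exact dif_pos i.2
  · intro T
    apply Subtype.ext
    ext i j
    change (if h : i < N then T.1 i j else 0) = T.1 i j
    split_ifs with h
    · rfl
    · exact (T.1.zeros fun h' => h (hi h')).symm
  · intro t
    apply Subtype.ext
    apply Subtype.ext
    funext i j
    exact dif_pos i.2

/-! ### Elementary symmetric functions are Schur positive -/

theorem coeff_elementarySymmetric (n : ℕ) {N : ℕ} {d : ℕ →₀ ℕ}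
    (hd : d.support ⊆ Finset.range N) :
    MvPowerSeries.coeff d (elementarySymmetric n) =
      MvPowerSeries.coeff d (∑ t ∈ Finset.powersetCard n (Finset.range N),
        ∏ i ∈ t, (MvPowerSeries.X i : MvPowerSeries ℕ ℚ)) := by
  classical
  have hprod (t : Finset ℕ) : ∏ i ∈ t, (MvPowerSeries.X i : MvPowerSeries ℕ ℚ) =
      MvPowerSeries.monomial (setWeight t) 1 := by
    induction t using Finset.induction_on with
    | empty => rfl
    | insert i t hi ih =>
      rw [Finset.prod_insert hi, ih, MvPowerSeries.X, MvPowerSeries.monomial_mul_monomial,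
        mul_one, setWeight, setWeight, Finset.sum_insert hi]
  have hsupp (t : Finset ℕ) (ht : setWeight t = d) : t ⊆ Finset.range N := fun i hi => hd (by
    rw [← ht, setWeight, Finsupp.mem_support_iff, Finsupp.finsetSum_apply]
    refine (Finset.sum_pos' (fun _ _ => Nat.zero_le _) ⟨i, hi, ?_⟩).ne'
    simp)
  rw [map_sum, elementarySymmetric, coeff_monomialSum]
  simp only [hprod, MvPowerSeries.coeff_monomial]
  rw [Finset.sum_boole, ← Nat.card_eq_finsetCard]
  congr 1
  exact Nat.card_congr
    { toFun := fun s => ⟨s.1.1, Finset.mem_filter.2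
        ⟨Finset.mem_powersetCard.2 ⟨hsupp _ s.2, s.1.2⟩, s.2.symm⟩⟩
      invFun := fun t => ⟨⟨t.1, (Finset.mem_powersetCard.1 (Finset.mem_filter.1 t.2).1).2⟩,
        (Finset.mem_filter.1 t.2).2.symm⟩
      left_inv := fun _ => rfl
      right_inv := fun _ => rfl }

/-! ### Vertical strips and the dual Pieri rule -/

namespace YoungDiagram

theorem finite_setOf_card_eq (k : ℕ) : {ν : YoungDiagram | ν.card = k}.Finite := by
  refine Set.Finite.of_injOn (f := YoungDiagram.cells)
    (t := (Finset.range k ×ˢ Finset.range k).powerset) ?_ (fun μ _ ν _ h => YoungDiagram.ext h)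
    (Finset.finite_toSet _)
  rintro ν rfl
  rw [Finset.mem_coe, Finset.mem_powerset]
  rintro ⟨i, j⟩ h
  rw [YoungDiagram.mem_cells] at h
  have hi := h
  have hj := h
  rw [YoungDiagram.mem_iff_lt_colLen, YoungDiagram.colLen_eq_card] at hi
  rw [YoungDiagram.mem_iff_lt_rowLen, YoungDiagram.rowLen_eq_card] at hj
  rw [Finset.mem_product, Finset.mem_range, Finset.mem_range]
  exact ⟨hi.trans_le (Finset.card_le_card (Finset.filter_subset _ _)),
    hj.trans_le (Finset.card_le_card (Finset.filter_subset _ _))⟩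

theorem sum_rowLen (ν : YoungDiagram) {N : ℕ} (hN : ν.card ≤ N) :
    ∑ i : Fin N, ν.rowLen i = ν.card := by
  have h := ν.sum_cells hN fun _ _ => 1
  simpa using h.symm

/-- The Young diagrams obtained from `μ` by adding a vertical strip of size `n`. -/
noncomputable def addVerticalStrip (μ : YoungDiagram) (n : ℕ) : Finset YoungDiagram :=
  ((finite_setOf_card_eq (μ.card + n)).subset
    (Set.sep_subset _ fun ν => ∀ i, μ.rowLen i ≤ ν.rowLen i ∧ ν.rowLen i ≤ μ.rowLen i + 1)).toFinset

theorem mem_addVerticalStrip {μ ν : YoungDiagram} {n : ℕ} :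
    ν ∈ μ.addVerticalStrip n ↔ ν.card = μ.card + n ∧
      ∀ i, μ.rowLen i ≤ ν.rowLen i ∧ ν.rowLen i ≤ μ.rowLen i + 1 := by
  rw [addVerticalStrip, Set.Finite.mem_toFinset]
  rfl

theorem exists_rowLen_eq {N : ℕ} {r : Fin N → ℕ} (hr : Antitone r) :
    ∃ ν : YoungDiagram, (∀ i : Fin N, ν.rowLen i = r i) ∧ (∀ i, N ≤ i → ν.rowLen i = 0) ∧
      ν.card = ∑ i, r i := by
  have hmem (c : ℕ × ℕ) : c ∈ ofRowLens (List.ofFn r) hr.sortedGE_ofFn ↔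
      ∃ h : c.1 < N, c.2 < r ⟨c.1, h⟩ := by
    rw [mem_ofRowLens]
    simp
  have h1 (i : Fin N) : (ofRowLens (List.ofFn r) hr.sortedGE_ofFn).rowLen i = r i := by
    refine eq_of_forall_lt_iff fun j => ?_
    rw [← mem_iff_lt_rowLen, hmem]
    simp
  refine ⟨ofRowLens (List.ofFn r) hr.sortedGE_ofFn, h1, fun i hi => ?_, ?_⟩
  · by_contra h
    have := mem_iff_lt_rowLen.2 (Nat.pos_of_ne_zero h)
    rw [hmem] at this
    exact absurd this.1 (not_lt.2 hi)
  · rw [YoungDiagram.card, Finset.card_eq_sum_ones,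
      Finset.sum_finset_product (γ := ℕ) (α := ℕ) _ (Finset.range N)
        fun i => Finset.range ((ofRowLens (List.ofFn r) hr.sortedGE_ofFn).rowLen i),
      Finset.sum_range]
    · simp [h1]
    · rintro ⟨i, j⟩
      rw [YoungDiagram.mem_cells, Finset.mem_range, Finset.mem_range, ← mem_iff_lt_rowLen]
      exact ⟨fun h => ⟨((hmem _).1 h).1, h⟩, fun h => h.2⟩

end YoungDiagram

/-- Antitone tuples in the box are the row lengths of diagrams; the other tuples contribute zero.
The bound on N leaves room for every added cell. -/
theorem sum_gelfandTsetlinSum_addVerticalStrip {R : Type*} [CommRing R] (x : ℕ → R)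
    (μ : YoungDiagram) (n : ℕ) {N : ℕ} (hN : μ.card + n ≤ N) :
    ∑ ν ∈ μ.addVerticalStrip n, gelfandTsetlinSum x N (fun i => ν.rowLen i) =
      ∑ ν ∈ Fintype.piFinset fun i : Fin N => Finset.Icc (μ.rowLen i) (μ.rowLen i + 1) with
        ∑ i : Fin N, (ν i - μ.rowLen i) = n, gelfandTsetlinSum x N ν := by
  classical
  rw [← Finset.sum_filter_of_ne (p := Antitone)
    (s := {ν ∈ Fintype.piFinset _ | ∑ i : Fin N, (ν i - μ.rowLen i) = n})]
  swap
  · intro ν _ h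
    by_contra h'
    exact h (gelfandTsetlinSum_eq_zero x h')
  have hμ := μ.sum_rowLen (le_of_add_le_left hN)
  refine Finset.sum_nbij (fun ν i => ν.rowLen i) ?_ ?_ ?_ fun _ _ => rfl
  · intro ν hν
    obtain ⟨h1, h2⟩ := YoungDiagram.mem_addVerticalStrip.1 hν
    simp only [Finset.mem_filter, Fintype.mem_piFinset, Finset.mem_Icc]
    refine ⟨⟨fun i => h2 i, ?_⟩, ν.antitone_rowLen N⟩
    rw [Finset.sum_tsub_distrib _ fun (i : Fin N) _ => (h2 i).1, hμ, ν.sum_rowLen (h1.trans_le hN), h1,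
      Nat.add_sub_cancel_left]
  · intro ν hν ν' hν' h
    have h1 := (YoungDiagram.mem_addVerticalStrip.1 hν).1
    have h1' := (YoungDiagram.mem_addVerticalStrip.1 hν').1
    apply YoungDiagram.ext
    ext ⟨i, j⟩
    rw [YoungDiagram.mem_cells, YoungDiagram.mem_cells, YoungDiagram.mem_iff_lt_rowLen,
      YoungDiagram.mem_iff_lt_rowLen]
    rcases lt_or_ge i N with hi | hi
    · rw [show ν.rowLen i = ν'.rowLen i from congrFun h ⟨i, hi⟩]
    · rw [ν.rowLen_eq_zero (by omega), ν'.rowLen_eq_zero (by omega)]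
  · intro r hr
    simp only [Finset.coe_filter, Set.mem_ofPred_eq, Finset.mem_filter, Fintype.mem_piFinset,
      Finset.mem_Icc] at hr
    obtain ⟨⟨h1, h2⟩, h3⟩ := hr
    obtain ⟨ν, hν, hν0, hcard⟩ := YoungDiagram.exists_rowLen_eq h3
    refine ⟨ν, YoungDiagram.mem_addVerticalStrip.2 ⟨?_, fun i => ?_⟩, funext hν⟩
    · rw [Finset.sum_tsub_distrib _ fun i _ => (h1 i).1, hμ] at h2
      have h4 : ∑ i : Fin N, μ.rowLen i ≤ ∑ i, r i := Finset.sum_le_sum fun i _ => (h1 i).1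
      rw [hμ] at h4
      omega
    · rcases lt_or_ge i N with hi | hi
      · rw [show ν.rowLen i = r ⟨i, hi⟩ from hν ⟨i, hi⟩]
        exact h1 ⟨i, hi⟩
      · rw [hν0 i hi, μ.rowLen_eq_zero (by omega)]
        omega

/-- The dual Pieri rule. -/
theorem elementarySymmetric_mul_schurFunction (n : ℕ) (μ : YoungDiagram) :
    elementarySymmetric n * schurFunction μ = ∑ ν ∈ μ.addVerticalStrip n, schurFunction ν := by
  classical
  ext d
  -- N is large enough for every diagram involved and every variable occurring in the monomial d.
  obtain ⟨N, hN, hd⟩ : ∃ N, μ.card + n ≤ N ∧ d.support ⊆ Finset.range N :=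
    ⟨max (μ.card + n) (d.support.sup id + 1), le_max_left _ _, fun i hi => Finset.mem_range.2
      ((Nat.lt_succ_of_le (Finset.le_sup (f := id) hi)).trans_le (le_max_right _ _))⟩
  have h : MvPowerSeries.coeff d (∑ ν ∈ μ.addVerticalStrip n, schurFunction ν) =
      MvPowerSeries.coeff d (∑ ν ∈ μ.addVerticalStrip n,
        gelfandTsetlinSum MvPowerSeries.X N fun i => ν.rowLen i) := by
    rw [map_sum, map_sum]
    exact Finset.sum_congr rfl fun ν hν => coeff_schurFunction ν
      ((YoungDiagram.mem_addVerticalStrip.1 hν).1.trans_le hN) hd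
  rw [h, sum_gelfandTsetlinSum_addVerticalStrip _ _ _ hN,
    ← sum_powersetCard_mul_gelfandTsetlinSum _ _ (μ.antitone_rowLen N), MvPowerSeries.coeff_mul,
    MvPowerSeries.coeff_mul]
  refine Finset.sum_congr rfl fun p hp => ?_
  rw [Finset.HasAntidiagonal.mem_antidiagonal] at hp
  have h1 : p.1.support ⊆ Finset.range N :=
    (Finsupp.support_mono (hp ▸ le_self_add)).trans hd
  have h2 : p.2.support ⊆ Finset.range N :=
    (Finsupp.support_mono (hp ▸ le_add_self)).trans hd
  rw [coeff_elementarySymmetric n h1, coeff_schurFunction μ (le_of_add_le_left hN) h2]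

theorem schurFunction_bot : schurFunction ⊥ = 1 := by
  have : Unique (SemistandardYoungTableau ⊥) :=
    ⟨⟨SemistandardYoungTableau.highestWeight ⊥⟩, fun T => by
      ext i j
      rw [T.zeros (YoungDiagram.notMem_bot _), SemistandardYoungTableau.zeros _
        (YoungDiagram.notMem_bot _)]⟩
  rw [schurFunction, monomialSum_unique, tableauWeight, YoungDiagram.cells_bot, Finset.sum_empty]
  rfl

/-! ### Closure properties of positivity; from e-positive to Schur positive -/

namespace IsPositiveIn

variable {ι : Type*} {b : ι → MvPowerSeries ℕ ℚ} {f g : MvPowerSeries ℕ ℚ}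

theorem self (i : ι) : IsPositiveIn b (b i) := by
  classical
  refine ⟨Finsupp.single i 1, fun j => ?_, by simp⟩
  rw [Finsupp.single_apply]
  split_ifs <;> simp

theorem zero : IsPositiveIn b 0 := ⟨0, fun _ => le_rfl, by simp⟩

theorem add (hf : IsPositiveIn b f) (hg : IsPositiveIn b g) : IsPositiveIn b (f + g) := by
  classical
  obtain ⟨c, hc, rfl⟩ := hf
  obtain ⟨c', hc', rfl⟩ := hg
  refine ⟨c + c', fun i => add_nonneg (hc i) (hc' i), ?_⟩
  rw [Finsupp.sum_add_index' (by simp) fun i a a' => add_smul a a' (b i)]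

theorem smul (hf : IsPositiveIn b f) {a : ℚ} (ha : 0 ≤ a) : IsPositiveIn b (a • f) := by
  obtain ⟨c, hc, rfl⟩ := hf
  refine ⟨a • c, fun i => mul_nonneg ha (hc i), ?_⟩
  rw [Finsupp.sum_smul_index' (by simp), Finsupp.smul_sum]
  simp [smul_smul]

theorem sum {α : Type*} {s : Finset α} {F : α → MvPowerSeries ℕ ℚ}
    (h : ∀ i ∈ s, IsPositiveIn b (F i)) : IsPositiveIn b (∑ i ∈ s, F i) :=
  Finset.sum_induction F (IsPositiveIn b) (fun _ _ => add) zero h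

theorem of_forall {L : MvPowerSeries ℕ ℚ →ₗ[ℚ] MvPowerSeries ℕ ℚ} {κ : Type*}
    {b' : κ → MvPowerSeries ℕ ℚ} (h : ∀ i, IsPositiveIn b' (L (b i))) (hf : IsPositiveIn b f) :
    IsPositiveIn b' (L f) := by
  obtain ⟨c, hc, rfl⟩ := hf
  rw [Finsupp.sum, map_sum]
  exact sum fun i _ => by
    rw [map_smul]
    exact (h i).smul (hc i)

theorem mul (h : ∀ i j, IsPositiveIn b (b i * b j)) (hf : IsPositiveIn b f)
    (hg : IsPositiveIn b g) : IsPositiveIn b (f * g) :=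
  of_forall (L := LinearMap.mulLeft ℚ f)
    (fun j => of_forall (L := LinearMap.mulRight ℚ (b j)) (fun i => h i j) hf) hg

end IsPositiveIn

/-- Products of e_λ merge the parts. The generator e_0 is treated apart, as partitions have positive
parts: it is 1, the value at the empty partition. -/
theorem isPositiveIn_elementaryPartition_of_mem_closure {f : MvPowerSeries ℕ ℚ}
    (hf : f ∈ Subsemiring.closure (Set.range elementarySymmetric)) :
    IsPositiveIn elementaryPartition f := by
  have hmul (p q : (n : ℕ) × n.Partition) :
      IsPositiveIn elementaryPartition (elementaryPartition p * elementaryPartition q) := by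
    have h : elementaryPartition p * elementaryPartition q = elementaryPartition
        ⟨(p.2.parts + q.2.parts).sum, ⟨p.2.parts + q.2.parts, fun h => by
          rcases Multiset.mem_add.1 h with h | h
          · exact p.2.parts_pos h
          · exact q.2.parts_pos h, rfl⟩⟩ := by
      simp [elementaryPartition]
    rw [h]
    exact IsPositiveIn.self _
  have hone : IsPositiveIn elementaryPartition 1 := by
    have h : elementaryPartition ⟨0, Nat.Partition.ofSums 0 0 rfl⟩ = 1 := by
      simp [elementaryPartition]
    rw [← h]
    exact IsPositiveIn.self _
  induction hf using Subsemiring.closure_induction with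
  | mem x hx =>
    obtain ⟨n, rfl⟩ := hx
    rcases Nat.eq_zero_or_pos n with rfl | hn
    · rw [elementarySymmetric_zero]
      exact hone
    · have h : elementaryPartition ⟨n, ⟨{n}, by simpa using hn, by simp⟩⟩ =
          elementarySymmetric n := by
        simp [elementaryPartition]
      rw [← h]
      exact IsPositiveIn.self _
  | zero => exact IsPositiveIn.zero
  | one => exact hone
  | add x y _ _ hx hy => exact hx.add hy
  | mul x y _ _ hx hy => exact IsPositiveIn.mul hmul hx hy

/-- Start from s_∅ = 1 and multiply by one e_n at a time; by the dual Pieri rule this sends each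
Schur function to a sum of Schur functions. -/
theorem isPositiveIn_schurFunction_elementaryPartition (p : (n : ℕ) × n.Partition) :
    IsPositiveIn schurFunction (elementaryPartition p) := by
  rw [elementaryPartition]
  induction p.2.parts using Multiset.induction_on with
  | empty =>
    rw [Multiset.map_zero, Multiset.prod_zero, ← schurFunction_bot]
    exact IsPositiveIn.self _
  | cons n s ih =>
    rw [Multiset.map_cons, Multiset.prod_cons]
    refine IsPositiveIn.of_forall (L := LinearMap.mulLeft ℚ (elementarySymmetric n))
      (fun μ => ?_) ih
    rw [LinearMap.mulLeft_apply, elementarySymmetric_mul_schurFunction]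
    exact IsPositiveIn.sum fun ν _ => IsPositiveIn.self ν

theorem SimpleGraph.IsEPositive.isSchurPositive {V : Type*} [Finite V] {G : SimpleGraph V}
    (h : G.IsEPositive) : G.IsSchurPositive :=
  IsPositiveIn.of_forall (L := LinearMap.id) isPositiveIn_schurFunction_elementaryPartition h

theorem mainTheorem2 (m l : ℕ) (hm : 3 ≤ m) (hl : 1 ≤ l) :
    (SimpleGraph.tadpole m l).lineGraph.IsEPositive ∧
      (SimpleGraph.tadpole m l).lineGraph.IsClawFree ∧
      (SimpleGraph.tadpole m l).lineGraph.IsSchurPositive := by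
  have h : (SimpleGraph.tadpole m l).lineGraph.IsEPositive := by
    rw [SimpleGraph.IsEPositive,
      SimpleGraph.chromaticSymmetricFunction_lineGraph_tadpole hm hl]
    exact isPositiveIn_elementaryPartition_of_mem_closure
      (doubleLassoSum_mem_closure m l (by omega) hl)
  exact ⟨h, SimpleGraph.isClawFree_lineGraph _, h.isSchurPositive⟩
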